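/- **Conventions.** Let $X$ be a scheme. For closed subschemes $Y_1=V(\mathcal M_1)$, $Y_2=V(\mathcal M_2)$ of $X$ ($\mathcal M_1,\mathcal M_2$ quasi-coherent ideals) write $Y_1\subset Y_2$ if $\mathcal M_2\subset\mathcal M_1$, and put $Y_1+Y_2=V(\mathcal M_1\mathcal M_2)$, $Y_1\cap Y_2=V(\mathcal M_1+\mathcal M_2)$, $Y_1\cup Y_2=V(\mathcal M_1\cap\mathcal M_2)$ (arbitrary intersections $\bigcap_e Y_e$ correspond to sums of ideals). A closed subscheme is locally principal if its ideal is locally generated by one element, and a Cartier divisor if its ideal is locally generated by one non-zero-divisor. **Dilatations.** For closed subschemes $Y_i$ and locally principal closed subschemes $D_i$ of $X$, $i$ in a finite set $I$, the dilatation $\mathrm{Bl}\{{}^{D_i}_{Y_i}\}_{i\in I}X$ is the $X$-affine scheme which over an affine open $\operatorname{Spec}A$ with $Y_i=V(M_i)$ and $D_i=V(a_i)$ is the spectrum of $A[\{M_i/a_i\}_{i\in I}]$, the subring of $A[1/\prod_i a_i]$ generated by the image of $A$ and all $m/a_i$ with $i\in I$, $m\in M_i$. Its structure morphism to $X$ is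 called the dilatation map. **Deformation spaces.** Let $I$ be a finite totally ordered set; subsets of $I$ carry the induced order, and $E_{\ge k}=\{e\in E: e\ge k\}$, $E_{>k}=\{e\in E: e>k\}$ for $E\subset I$, $k\in I$. A deformation datum on $X$ indexed by $I$ is a family $(X_i)_{i\in I}$ of closed subschemes of $X$ with $X_i\subset X_{i'}$ whenever $i\ge i'$, together with a family $(D_i)_{i\in I}$ of locally principal closed subschemes of $X$. Its deformation space is $$\mathbb D\big(({}^{D_i}_{X_i})_{i\in I}\,{}_X\big)=\mathrm{Bl}\Big\{{}^{\sum_{j\in I_{\ge i}}D_j}_{X_i}\Big\}_{i\in I}X .$$ If $X'\to X$ is a morphism and the $X'_i$ are closed subschemes of $X'$, then in $\mathbb D(({}^{D_i}_{X'_i})_{i\in I}\,{}_{X'})$ the $D_i$ denote the pullbacks of the $D_i$ to $X'$. **Theorem (Panelization isomorphism).** Let $X$ be a scheme with a deformation datum $(X_i,D_i)_{i\in I}$ indexed by a finite totally ordered set $I$ such that $X_i\cap D_j$ is a Cartier divisor in $X_i$ for all $i,j\in I$. Let $S\subset I$ and $K=I\setminus S$. Write $\mathbb D_S=\mathbb D(({}^{D_s}_{X_s})_{s\in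 S}\,{}_X)$ and let $\Pi:\mathbb D_S\to X$ be the dilatation map. (0) For every $k\in K$ there is a unique $X$-morphism $F(k,S):\mathbb D(({}^{D_s}_{X_s\cap X_k})_{s\in S}\,{}_{X_k})\to\mathbb D_S$, and it is a closed immersion. Its source is identified with the corresponding closed subscheme of $\mathbb D_S$. These closed subschemes of $\mathbb D_S$, for $k\in K$, and the pullbacks $\Pi^{-1}(D_k)$ form a deformation datum on $\mathbb D_S$ indexed by $K$; let $$\Phi:\ \mathbb D\Big(\big({}^{D_k}_{\mathbb D(({}^{D_s}_{X_s\cap X_k})_{s\in S}\,{}_{X_k})}\big)_{k\in K}\ {}_{\mathbb D_S}\Big)\to\mathbb D_S$$ be the dilatation map of its deformation space. (1) There is a unique $X$-morphism $$\Theta(S):\ \mathbb D\Big(\big({}^{D_k}_{\mathbb D(({}^{D_s}_{X_s\cap X_k})_{s\in S}\,{}_{X_k})}\big)_{k\in K}\ {}_{\mathbb D_S}\Big)\longrightarrow\mathbb D\big(({}^{D_i}_{X_i})_{i\in I}\,{}_X\big).$$ (2) There are unique $X$-morphisms from the source and from the target of $\Theta(S)$ to $\mathbb D_S$ (the first one is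 $\Phi$). With respect to them, $\Theta(S)$ is a $\mathbb D_S$-morphism, and it is the only $\mathbb D_S$-morphism from its source to its target. (3) Suppose that for all $k\in K$ with $S_{>k}\neq\emptyset$ the following two conditions on closed subschemes of $X$ hold. (a) For every $\theta\in\mathbb N^{S_{>k}}$ with $\theta\neq0$, putting $s'=\min\{s\in S_{>k}:\theta_s>0\}$, $$\Big(\sum_{s\in S_{>k}}\theta_sX_s\Big)\cup X_k=\Big(\sum_{s\in S_{>s'}}\theta_sX_s\Big)+(\theta_{s'}-1)X_{s'}+X_k .$$ (b) For every set $E$ and all families $\theta^{(e)}\in\mathbb N^{S_{>k}}$, $\gamma^{(e)}\in\mathbb N^{S}$ ($e\in E$), $$\Big(\bigcap_{e\in E}\big(\sum_{s\in S}\gamma^{(e)}_sD_s+\sum_{s\in S_{>k}}\theta^{(e)}_sX_s\big)\Big)\cup X_k=\bigcap_{e\in E}\Big(\sum_{s\in S}\gamma^{(e)}_sD_s+\big((\sum_{s\in S_{>k}}\theta^{(e)}_sX_s)\cup X_k\big)\Big).$$ Then $\Theta(S)$ is an isomorphism. -/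

import Mathlib

open AlgebraicGeometry CategoryTheory Limits
universe u v w
noncomputable section
namespace AlgebraicGeometry
namespace Scheme
namespace IdealSheafData

variable {X Y : Scheme.{u}}

/-- A closed subscheme is locally principal if its ideal is locally generated by one element. -/
def IsLocallyPrincipal (J : X.IdealSheafData) : Prop :=
  ∀ x : X, ∃ U : X.affineOpens, x ∈ U.1 ∧ ∃ a : Γ(X, U.1), J.ideal U = Ideal.span {a}

/-- A closed subscheme is a Cartier divisor if its ideal is locally generated by one
non-zero-divisor. -/
def IsCartier (J : X.IdealSheafData) : Prop :=
  ∀ x : X, ∃ U : X.affineOpens, x ∈ U.1 ∧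
    ∃ a ∈ nonZeroDivisors Γ(X, U.1), J.ideal U = Ideal.span {a}

lemma appLE_SpecMap_fromSpec {V : X.Opens} (hV : IsAffineOpen V) {R : CommRingCat.{u}}
    (φ : Γ(X, V) ⟶ R) (h : ⊤ ≤ (Spec.map φ ≫ hV.fromSpec) ⁻¹ᵁ V) :
    (Spec.map φ ≫ hV.fromSpec).appLE V ⊤ h = φ ≫ (ΓSpecIso R).inv := by
  have h1 : hV.fromSpec.appLE V ⊤ hV.fromSpec_preimage_self.ge = (ΓSpecIso Γ(X, V)).inv := by
    rw [Hom.appLE, hV.fromSpec_app_of_le V le_rfl, Category.assoc, Category.assoc,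
      ← Functor.map_comp, ← op_comp]
    have e1 : (homOfLE (le_refl V)).op = 𝟙 (Opposite.op V) := rfl
    rw [e1, X.presheaf.map_id, Category.id_comp]
    exact ((ΓSpecIso Γ(X, V)).inv ≫= (Spec Γ(X, V)).presheaf.map_id _).trans
      (Category.comp_id _)
  rw [ΓSpecIso_inv_naturality, ← h1]
  rw [Hom.appTop, Hom.app_eq_appLE]
  exact (Hom.appLE_comp_appLE (Spec.map φ) hV.fromSpec V ⊤ ⊤ _ le_rfl).symm

lemma map_le_ideal_comap (J : Y.IdealSheafData) (f : X ⟶ Y) (U : Y.affineOpens) (V : X.affineOpens)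
    (h : V.1 ≤ f ⁻¹ᵁ U.1) :
    (J.ideal U).map (f.appLE U.1 V.1 h).hom ≤ (J.comap f).ideal V := by
  rw [Ideal.map_le_iff_le_comap]
  intro a ha
  have h1 : J ≤ ((J.comap f).subschemeι ≫ f).ker := J.le_map_comap f
  have h2 := Hom.ideal_ker_le _ U (h1 U ha)
  rw [Ideal.mem_comap, ← ker_subschemeι_app, RingHom.mem_ker]
  rw [RingHom.mem_ker] at h2
  have h3 : f.appLE U.1 V.1 h ≫ (J.comap f).subschemeι.app V.1 =
      ((J.comap f).subschemeι ≫ f).app U.1 ≫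
        (J.comap f).subscheme.presheaf.map (homOfLE (by exact fun x hx => h hx)).op := by
    rw [Hom.app_eq_appLE (J.comap f).subschemeι, Hom.appLE_comp_appLE]
    rfl
  have h4 := congr($h3 a)
  simp only [CommRingCat.comp_apply] at h4
  rw [h4, h2, map_zero]

lemma ideal_comap (J : Y.IdealSheafData) (f : X ⟶ Y) (U : Y.affineOpens) (V : X.affineOpens)
    (h : V.1 ≤ f ⁻¹ᵁ U.1) :
    (J.comap f).ideal V = (J.ideal U).map (f.appLE U.1 V.1 h).hom := by
  refine le_antisymm ?_ (J.map_le_ideal_comap f U V h)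
  set I := (J.ideal U).map (f.appLE U.1 V.1 h).hom with hI
  let z : Spec (.of (Γ(X, V.1) ⧸ I)) ⟶ X :=
    Spec.map (CommRingCat.ofHom (Ideal.Quotient.mk I)) ≫ V.2.fromSpec
  have hz : J ≤ (z ≫ f).ker := by
    let q : Γ(Y, U.1) ⧸ J.ideal U →+* Γ(X, V.1) ⧸ I :=
      Ideal.quotientMap I (f.appLE U.1 V.1 h).hom Ideal.le_comap_map
    have : z ≫ f = (Spec.map (CommRingCat.ofHom q) ≫ J.subschemeCover.f U) ≫ J.subschemeι := by
      have h1 := IsAffineOpen.SpecMap_appLE_fromSpec f U.2 V.2 h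
      have h2 : CommRingCat.ofHom (Ideal.Quotient.mk (J.ideal U)) ≫ CommRingCat.ofHom q =
        f.appLE U.1 V.1 h ≫ CommRingCat.ofHom (Ideal.Quotient.mk I) := rfl
      calc z ≫ f = Spec.map (CommRingCat.ofHom (Ideal.Quotient.mk I)) ≫ V.2.fromSpec ≫ f :=
            Category.assoc _ _ _
        _ = Spec.map (CommRingCat.ofHom (Ideal.Quotient.mk I)) ≫
            Spec.map (f.appLE U.1 V.1 h) ≫ IsAffineOpen.fromSpec U.2 :=
            congrArg (_ ≫ ·) h1.symm
        _ = Spec.map (CommRingCat.ofHom q) ≫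
            Spec.map (CommRingCat.ofHom (Ideal.Quotient.mk (J.ideal U))) ≫
              IsAffineOpen.fromSpec U.2 := by
            rw [← Spec.map_comp_assoc, ← h2, Spec.map_comp_assoc]
        _ = Spec.map (CommRingCat.ofHom q) ≫ J.subschemeCover.f U ≫ J.subschemeι :=
            congrArg (_ ≫ ·)
              ((J.glueDataObjι_ι U).symm.trans (J.subschemeCover_map_subschemeι U).symm)
        _ = _ := (Category.assoc _ _ _).symm
    rw [this]
    conv_lhs => rw [← J.ker_subschemeι]
    exact Hom.le_ker_comp _ _
  have hz' : J.comap f ≤ z.ker := by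
    refine le_map_iff_comap_le.mp ?_
    rw [map_ker]
    exact hz
  intro a ha
  have h5 := Hom.ideal_ker_le _ V (hz' V ha)
  rw [RingHom.mem_ker] at h5
  have hT : (⊤ : (Spec (.of (Γ(X, V.1) ⧸ I))).Opens) ≤ z ⁻¹ᵁ V.1 := by
    intro x _
    exact (IsAffineOpen.fromSpec_preimage_self V.2).ge
      (Set.mem_univ (Spec.map (CommRingCat.ofHom (Ideal.Quotient.mk I)) x))
  have h6 : z.appLE V.1 ⊤ hT = CommRingCat.ofHom (Ideal.Quotient.mk I) ≫
      (ΓSpecIso (.of (Γ(X, V.1) ⧸ I))).inv := appLE_SpecMap_fromSpec V.2 _ _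
  have h8 : z.appLE V.1 ⊤ hT a = 0 := by
    rw [Hom.appLE, CommRingCat.comp_apply, h5, map_zero]
  rw [h6, CommRingCat.comp_apply] at h8
  have h9 := congrArg (ΓSpecIso (.of (Γ(X, V.1) ⧸ I))).hom h8
  rw [map_zero, ← CommRingCat.comp_apply, Iso.inv_hom_id] at h9
  exact Ideal.Quotient.eq_zero_iff_mem.mp h9

lemma IsLocallyPrincipal.mul {I J : X.IdealSheafData} (hI : I.IsLocallyPrincipal)
    (hJ : J.IsLocallyPrincipal) : (I * J).IsLocallyPrincipal := by
  intro x
  obtain ⟨U, hxU, a, ha⟩ := hI x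
  obtain ⟨V, hxV, b, hb⟩ := hJ x
  obtain ⟨f, g, hfg, hxf⟩ := exists_basicOpen_le_affine_inter U.2 V.2 x ⟨hxU, hxV⟩
  have h1 : X.basicOpen f ≤ V.1 := hfg.trans_le (X.basicOpen_le g)
  refine ⟨X.affineBasicOpen f, hxf,
    (X.presheaf.map (homOfLE (X.basicOpen_le f)).op).hom a *
      (X.presheaf.map (homOfLE h1).op).hom b, ?_⟩
  rw [ideal_mul, Pi.mul_apply, ← I.map_ideal (X.affineBasicOpen_le f),
    ← J.map_ideal (U := X.affineBasicOpen f) (V := V) h1, ha, hb, Ideal.map_span, Ideal.map_span,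
    Set.image_singleton, Set.image_singleton, Ideal.span_singleton_mul_span_singleton]
  rfl

lemma isLocallyPrincipal_top : (⊤ : X.IdealSheafData).IsLocallyPrincipal := by
  intro x
  obtain ⟨U, hxU⟩ := TopologicalSpace.Opens.mem_iSup.mp
    ((iSup_affineOpens_eq_top X).ge (Set.mem_univ x))
  exact ⟨U, hxU, 1, by simp⟩

lemma IsLocallyPrincipal.prod {ι : Type*} (s : Finset ι) {J : ι → X.IdealSheafData}
    (hJ : ∀ i ∈ s, (J i).IsLocallyPrincipal) : (∏ i ∈ s, J i).IsLocallyPrincipal :=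
  Finset.prod_induction _ _ (fun _ _ => .mul) isLocallyPrincipal_top hJ

lemma IsLocallyPrincipal.comap {J : Y.IdealSheafData} (hJ : J.IsLocallyPrincipal) (f : X ⟶ Y) :
    (J.comap f).IsLocallyPrincipal := by
  intro x
  obtain ⟨U, hxU, a, ha⟩ := hJ (f x)
  obtain ⟨_, ⟨V, hV, rfl⟩, hxV, hVU⟩ :=
    X.isBasis_affineOpens.exists_subset_of_mem_open (show x ∈ f ⁻¹ᵁ U.1 from hxU) (f ⁻¹ᵁ U.1).2
  refine ⟨⟨V, hV⟩, hxV, (f.appLE U.1 V hVU).hom a, ?_⟩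
  rw [J.ideal_comap f U ⟨V, hV⟩ hVU, ha, Ideal.map_span, Set.image_singleton]

lemma IsLocallyPrincipal.fg {J : X.IdealSheafData} (hJ : J.IsLocallyPrincipal)
    (U : X.affineOpens) : (J.ideal U).FG := by
  have key : ∀ x : U.1, ∃ f : Γ(X, U.1), x.1 ∈ X.basicOpen f ∧
      (J.ideal (X.affineBasicOpen f)).FG := by
    intro x
    obtain ⟨V, hxV, b, hb⟩ := hJ x.1
    obtain ⟨f, g, hfg, hxf⟩ := exists_basicOpen_le_affine_inter U.2 V.2 x.1 ⟨x.2, hxV⟩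
    have h1 : X.basicOpen f ≤ V.1 := hfg.trans_le (X.basicOpen_le g)
    refine ⟨f, hxf, ?_⟩
    rw [← J.map_ideal (U := X.affineBasicOpen f) (V := V) h1, hb]
    exact Ideal.FG.map (Submodule.fg_span_singleton b) _
  choose f hf hfg using key
  have hs : Ideal.span (Set.range f) = ⊤ := by
    rw [← U.2.self_le_iSup_basicOpen_iff]
    exact fun x hxV ↦ TopologicalSpace.Opens.mem_iSup.mpr ⟨⟨_, _, rfl⟩, hf ⟨x, hxV⟩⟩
  refine Ideal.fg_of_localizationSpan _ hs ?_
  rintro ⟨_, x, rfl⟩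
  have := U.2.isLocalization_basicOpen (f x)
  have e : Γ(X, X.basicOpen (f x)) ≃ₐ[Γ(X, U.1)] Localization.Away (f x) :=
    IsLocalization.algEquiv (.powers (f x)) _ _
  have h2 := hfg x
  rw [← J.map_ideal_basicOpen U (f x)] at h2
  have h3 := Ideal.FG.map h2 e.toRingEquiv.toRingHom
  have h4 : Ideal.map e.toRingEquiv.toRingHom
      (Ideal.map (X.presheaf.map (homOfLE (X.basicOpen_le (f x))).op).hom (J.ideal U)) =
      Ideal.map (algebraMap Γ(X, U.1) (Localization.Away (f x))) (J.ideal U) := by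
    refine (Ideal.map_map _ _).trans ?_
    congr 1
    ext a
    exact e.commutes a
  exact h4 ▸ h3

end IdealSheafData
end Scheme

open Scheme.AffineZariskiSite TopologicalSpace

namespace Scheme

/-- A multi-center on `X`: closed subschemes `Y i` (centers) and locally principal closed
subschemes `D i` (divisors), all given by their quasi-coherent ideals. -/
structure Multicenter (X : Scheme.{u}) (ι : Type v) where
  center : ι → X.IdealSheafData
  divisor : ι → X.IdealSheafData
  isLocallyPrincipal : ∀ i, (divisor i).IsLocallyPrincipal

namespace Multicenter

variable {X : Scheme.{u}} {ι : Type v} [Fintype ι] (c : X.Multicenter ι)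

/-- The open complement of all the divisors. -/
def compl : X.Opens := (∏ i, c.divisor i).support.compl

/-- The restriction map from `U` to the part of `U` outside of the divisors. For `U = Spec A` and
`D i = V(a i)` this is the localization `A → A[1 / ∏ a i]`. -/
def res (U : X.Opens) : Γ(X, U) →+* Γ(X, U ⊓ c.compl) :=
  (X.presheaf.map (homOfLE inf_le_left).op).hom

/-- The fractions with numerator in the ideal of `Y i` and denominator `D i` over an affine open
`U`: the sections outside of the divisors that are multiplied by the ideal of `D i` into
the ideal of `Y i`. For `U = Spec A`, `Y i = V(M)` and `D i = V(a)`, these are the `m / a` with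
`m ∈ M`. -/
def fractions (U : X.AffineZariskiSite) (i : ι) : Set Γ(X, U.1 ⊓ c.compl) :=
  {b | ∀ a ∈ (c.divisor i).ideal ⟨U.1, U.2⟩, ∃ m ∈ (c.center i).ideal ⟨U.1, U.2⟩,
    c.res U.1 a * b = c.res U.1 m}

/-- The dilatation ring over an affine open `U`: for `U = Spec A`, `Y i = V(M i)` and
`D i = V(a i)`, this is the ring `A[{M i / a i}]`, the subring of `A[1 / ∏ a i]` that is
generated by (the image of) `A` and by all fractions `m / a i` with `m ∈ M i`. -/
def ring (U : X.AffineZariskiSite) : Subring Γ(X, U.1 ⊓ c.compl) :=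
  Subring.closure (Set.range (c.res U.1) ∪ ⋃ i, c.fractions U i)

/-- Restriction between the parts of two opens outside of the divisors. -/
def resLE {U V : X.Opens} (h : U ≤ V) : Γ(X, V ⊓ c.compl) →+* Γ(X, U ⊓ c.compl) :=
  (X.presheaf.map (homOfLE (inf_le_inf_right _ h)).op).hom

lemma resLE_res {U V : X.Opens} (h : U ≤ V) (a : Γ(X, V)) :
    c.resLE h (c.res V a) = c.res U ((X.presheaf.map (homOfLE h).op).hom a) := by
  simp only [resLE, res]
  rw [← CommRingCat.comp_apply, ← CommRingCat.comp_apply, ← Functor.map_comp, ← Functor.map_comp]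
  rfl

lemma resLE_mem_fractions {U V : X.AffineZariskiSite} (h : U ≤ V) {i : ι}
    {b : Γ(X, V.1 ⊓ c.compl)} (hb : b ∈ c.fractions V i) :
    c.resLE (toOpens_mono h) b ∈ c.fractions U i := by
  have h' : (⟨U.1, U.2⟩ : X.affineOpens) ≤ ⟨V.1, V.2⟩ := toOpens_mono h
  intro a ha
  rw [← (c.divisor i).map_ideal h'] at ha
  rw [← (c.center i).map_ideal h']
  refine Submodule.span_induction ?_ ?_ ?_ ?_ ha
  · rintro _ ⟨x, hx, rfl⟩
    obtain ⟨m, hm, e⟩ := hb x hx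
    refine ⟨_, Ideal.mem_map_of_mem _ hm, ?_⟩
    exact (congrArg (· * _) (c.resLE_res (toOpens_mono h) x).symm).trans
      ((map_mul _ _ _).symm.trans ((congrArg _ e).trans (c.resLE_res (toOpens_mono h) m)))
  · exact ⟨0, Ideal.zero_mem _, by simp⟩
  · rintro x y _ _ ⟨m, hm, e⟩ ⟨n, hn, e'⟩
    exact ⟨m + n, Ideal.add_mem _ hm hn, by rw [map_add, add_mul, e, e', map_add]⟩
  · rintro r x _ ⟨m, hm, e⟩
    exact ⟨r * m, Ideal.mul_mem_left _ _ hm, by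
      rw [smul_eq_mul, map_mul, mul_assoc, e, map_mul]⟩

lemma res_mem_ring (U : X.AffineZariskiSite) (a : Γ(X, U.1)) : c.res U.1 a ∈ c.ring U :=
  Subring.subset_closure (.inl ⟨a, rfl⟩)

lemma mem_ring_of_mem_fractions {U : X.AffineZariskiSite} {i : ι} {b : Γ(X, U.1 ⊓ c.compl)}
    (hb : b ∈ c.fractions U i) : b ∈ c.ring U :=
  Subring.subset_closure (.inr (Set.mem_iUnion_of_mem i hb))

lemma resLE_mem_ring {U V : X.AffineZariskiSite} (h : U ≤ V)
    {b : Γ(X, V.1 ⊓ c.compl)} (hb : b ∈ c.ring V) : c.resLE (toOpens_mono h) b ∈ c.ring U := by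
  suffices c.ring V ≤ (c.ring U).comap (c.resLE (toOpens_mono h)) from this hb
  refine Subring.closure_le.mpr ?_
  rintro _ (⟨a, rfl⟩ | hb)
  · exact (congrArg (· ∈ c.ring U) (c.resLE_res (toOpens_mono h) a)).mpr (c.res_mem_ring U _)
  · obtain ⟨i, hb⟩ := Set.mem_iUnion.mp hb
    exact c.mem_ring_of_mem_fractions (c.resLE_mem_fractions h hb)

lemma isLocallyPrincipal_prod : (∏ i, c.divisor i).IsLocallyPrincipal :=
  .prod _ fun i _ => c.isLocallyPrincipal i

lemma isCompact_inf_compl (U : X.AffineZariskiSite) : IsCompact (U.1 ⊓ c.compl : X.Opens).1 := by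
  obtain ⟨s, hs⟩ := c.isLocallyPrincipal_prod.fg ⟨U.1, U.2⟩
  have h : (U.1 ⊓ c.compl : X.Opens) = ⨆ a ∈ s, X.basicOpen a := by
    ext x
    by_cases hx : x ∈ U.1
    · have h1 := IdealSheafData.mem_support_iff_of_mem (I := ∏ i, c.divisor i)
        (U := ⟨U.1, U.2⟩) hx
      rw [← hs, Scheme.zeroLocus_span] at h1
      simp only [compl, Opens.coe_inf, Opens.coe_iSup]
      simp only [Set.mem_inter_iff, SetLike.mem_coe, hx, true_and, Set.mem_iUnion]
      change x ∉ (∏ i, c.divisor i).support ↔ _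
      rw [h1, Scheme.mem_zeroLocus_iff]
      simp
    · constructor
      · exact fun h => absurd h.1 hx
      · intro h
        simp only [Opens.coe_iSup, Set.mem_iUnion] at h
        obtain ⟨a, -, h⟩ := h
        exact absurd (X.basicOpen_le a h) hx
  rw [h]
  have : (⨆ a ∈ s, X.basicOpen a : X.Opens).1 = ⋃ a ∈ s, (X.basicOpen a).1 := by
    ext; simp
  rw [this]
  exact s.isCompact_biUnion fun a _ => (U.2.basicOpen a).isCompact

lemma isQuasiSeparated_inf_compl (U : X.AffineZariskiSite) :
    IsQuasiSeparated (U.1 ⊓ c.compl : X.Opens).1 :=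
  U.2.isQuasiSeparated.of_subset inf_le_left

lemma inf_compl_basicOpen (U : X.AffineZariskiSite) (f : Γ(X, U.1)) :
    (U.basicOpen f).1 ⊓ c.compl = X.basicOpen (c.res U.1 f) := by
  simp only [res]
  rw [X.basicOpen_res]
  have := X.basicOpen_le f
  ext x
  simp only [basicOpen, Opens.coe_inf, Set.mem_inter_iff, SetLike.mem_coe]
  constructor
  · exact fun h => ⟨⟨this h.1, h.2⟩, h.1⟩
  · exact fun h => ⟨h.2, h.1.2⟩

lemma isLocalization_away_of_eq {V V' : X.Opens} (hc : IsCompact V.1) (hq : IsQuasiSeparated V.1)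
    (f : Γ(X, V)) (e : V' = X.basicOpen f) (h : V' ≤ V) :
    letI := (X.presheaf.map (homOfLE h).op).hom.toAlgebra
    IsLocalization.Away f Γ(X, V') := by
  subst e
  exact isLocalization_basicOpen_of_qcqs hc hq f

lemma isLocalization_resLE (U : X.AffineZariskiSite) (f : Γ(X, U.1)) :
    letI := (c.resLE (toOpens_mono (U.basicOpen_le f))).toAlgebra
    IsLocalization.Away (c.res U.1 f) Γ(X, (U.basicOpen f).1 ⊓ c.compl) :=
  isLocalization_away_of_eq (c.isCompact_inf_compl U) (c.isQuasiSeparated_inf_compl U) _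
    (c.inf_compl_basicOpen U f) _

lemma exists_pow_mul_eq_resLE (U : X.AffineZariskiSite) (f : Γ(X, U.1))
    (b : Γ(X, (U.basicOpen f).1 ⊓ c.compl)) :
    ∃ (n : ℕ) (b' : Γ(X, U.1 ⊓ c.compl)),
      c.resLE (toOpens_mono (U.basicOpen_le f)) (c.res U.1 f ^ n) * b =
        c.resLE (toOpens_mono (U.basicOpen_le f)) b' := by
  let := (c.resLE (toOpens_mono (U.basicOpen_le f))).toAlgebra
  have := c.isLocalization_resLE U f
  obtain ⟨⟨b', ⟨_, n, rfl⟩⟩, h⟩ := IsLocalization.surj (.powers (c.res U.1 f)) b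
  exact ⟨n, b', (mul_comm _ _).trans h⟩

lemma exists_pow_mul_eq_zero (U : X.AffineZariskiSite) (f : Γ(X, U.1))
    (b : Γ(X, U.1 ⊓ c.compl)) (hb : c.resLE (toOpens_mono (U.basicOpen_le f)) b = 0) :
    ∃ (n : ℕ), c.res U.1 f ^ n * b = 0 := by
  let := (c.resLE (toOpens_mono (U.basicOpen_le f))).toAlgebra
  have := c.isLocalization_resLE U f
  obtain ⟨⟨_, n, rfl⟩, h⟩ := IsLocalization.exists_of_eq (M := .powers (c.res U.1 f))
    (S := Γ(X, (U.basicOpen f).1 ⊓ c.compl)) (hb.trans (map_zero _).symm)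
  exact ⟨n, h.trans (mul_zero _)⟩

lemma exists_pow_mul_mem_ideal (I : X.IdealSheafData) (U : X.AffineZariskiSite) (f : Γ(X, U.1))
    (m : Γ(X, (U.basicOpen f).1)) (hm : m ∈ I.ideal ⟨(U.basicOpen f).1, (U.basicOpen f).2⟩) :
    ∃ (n : ℕ), ∃ m' ∈ I.ideal ⟨U.1, U.2⟩,
      (X.presheaf.map (homOfLE (toOpens_mono (U.basicOpen_le f))).op).hom (f ^ n) * m =
        (X.presheaf.map (homOfLE (toOpens_mono (U.basicOpen_le f))).op).hom m' := by
  have := U.2.isLocalization_basicOpen f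
  have h := I.map_ideal_basicOpen ⟨U.1, U.2⟩ f
  have hm' : m ∈ (I.ideal ⟨U.1, U.2⟩).map (algebraMap Γ(X, U.1) Γ(X, X.basicOpen f)) :=
    h.ge hm
  obtain ⟨⟨m', ⟨_, n, rfl⟩⟩, e⟩ :=
    (IsLocalization.mem_map_algebraMap_iff (.powers f) Γ(X, X.basicOpen f)).mp hm'
  exact ⟨n, m'.1, m'.2, (mul_comm _ _).trans e⟩

lemma exists_mem_fractions (U : X.AffineZariskiSite) (f : Γ(X, U.1)) {i : ι}
    {b : Γ(X, (U.basicOpen f).1 ⊓ c.compl)} (hb : b ∈ c.fractions (U.basicOpen f) i) :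
    ∃ (n : ℕ), ∃ b' ∈ c.fractions U i,
      c.resLE (toOpens_mono (U.basicOpen_le f)) (c.res U.1 f ^ n) * b =
        c.resLE (toOpens_mono (U.basicOpen_le f)) b' := by
  have hle := toOpens_mono (U.basicOpen_le f)
  obtain ⟨n₀, b₀, h₀⟩ := c.exists_pow_mul_eq_resLE U f b
  have key : ∀ a ∈ (c.divisor i).ideal ⟨U.1, U.2⟩, ∃ n : ℕ, ∃ m ∈ (c.center i).ideal ⟨U.1, U.2⟩,
      c.res U.1 a * (c.res U.1 f ^ n * b₀) = c.res U.1 m := by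
    intro a ha
    have h1 : (⟨(U.basicOpen f).1, (U.basicOpen f).2⟩ : X.affineOpens) ≤ ⟨U.1, U.2⟩ := hle
    obtain ⟨m, hm, e⟩ := hb _ ((c.divisor i).ideal_le_comap_ideal h1 ha)
    obtain ⟨n, m', hm', e'⟩ := exists_pow_mul_mem_ideal _ U f m hm
    have e'' := congrArg (c.res (U.basicOpen f).1) e'
    have h2 : c.resLE hle (c.res U.1 (f ^ n)) * c.res (U.basicOpen f).1 m =
        c.resLE hle (c.res U.1 m') := by
      rw [c.resLE_res, c.resLE_res, ← map_mul]
      exact e''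
    have e3 : c.resLE hle (c.res U.1 a) * b = c.res (U.basicOpen f).1 m := by
      rw [c.resLE_res]; exact e
    have h3 : c.resLE hle (c.res U.1 f ^ n * c.res U.1 a * b₀
        - c.res U.1 f ^ n₀ * c.res U.1 m') = 0 := by
      rw [map_sub, map_mul, map_mul (c.resLE hle) _ (c.res U.1 m'), ← h2, ← h₀, ← e3, map_mul,
        map_pow (c.res U.1) f n]
      ring
    obtain ⟨k, hk⟩ := c.exists_pow_mul_eq_zero U f _ h3
    refine ⟨n + k, f ^ (n₀ + k) * m', Ideal.mul_mem_left _ _ hm', ?_⟩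
    rw [map_mul, map_pow]
    linear_combination hk
  choose! N hN using key
  obtain ⟨s, hs⟩ := (c.isLocallyPrincipal i).fg ⟨U.1, U.2⟩
  refine ⟨s.sup N + n₀, c.res U.1 f ^ s.sup N * b₀, ?_, ?_⟩
  · intro a ha
    rw [← hs] at ha
    refine Submodule.span_induction ?_ ?_ ?_ ?_ ha
    · intro x hx
      obtain ⟨m, hm, e⟩ := hN x (hs ▸ Submodule.subset_span hx)
      refine ⟨f ^ (s.sup N - N x) * m, Ideal.mul_mem_left _ _ hm, ?_⟩
      rw [map_mul, ← e, map_pow]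
      conv_lhs => rw [← Nat.sub_add_cancel (Finset.le_sup (f := N) hx), pow_add]
      ring
    · exact ⟨0, Ideal.zero_mem _, by simp⟩
    · rintro x y _ _ ⟨m, hm, e⟩ ⟨n, hn, e'⟩
      exact ⟨m + n, Ideal.add_mem _ hm hn, by rw [map_add, add_mul, e, e', map_add]⟩
    · rintro r x _ ⟨m, hm, e⟩
      exact ⟨r * m, Ideal.mul_mem_left _ _ hm, by
        rw [smul_eq_mul, map_mul, mul_assoc, e, map_mul]⟩
  · rw [pow_add, map_mul, mul_assoc, h₀, map_mul]

lemma exists_mem_ring (U : X.AffineZariskiSite) (f : Γ(X, U.1))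
    {b : Γ(X, (U.basicOpen f).1 ⊓ c.compl)} (hb : b ∈ c.ring (U.basicOpen f)) :
    ∃ (n : ℕ), ∃ b' ∈ c.ring U,
      c.resLE (toOpens_mono (U.basicOpen_le f)) (c.res U.1 f ^ n) * b =
        c.resLE (toOpens_mono (U.basicOpen_le f)) b' := by
  have hle := toOpens_mono (U.basicOpen_le f)
  refine Subring.closure_induction ?_ ?_ ?_ ?_ ?_ ?_ hb
  · rintro _ (⟨a, rfl⟩ | hb)
    · have ha : a ∈ (⊤ : X.IdealSheafData).ideal ⟨(U.basicOpen f).1, (U.basicOpen f).2⟩ := by simp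
      obtain ⟨n, a', -, e⟩ := exists_pow_mul_mem_ideal _ U f a ha
      refine ⟨n, c.res U.1 a', c.res_mem_ring U a', ?_⟩
      rw [← map_pow, c.resLE_res, c.resLE_res, ← map_mul]
      exact congrArg _ e
    · obtain ⟨i, hb⟩ := Set.mem_iUnion.mp hb
      obtain ⟨n, b', hb', e⟩ := c.exists_mem_fractions U f hb
      exact ⟨n, b', c.mem_ring_of_mem_fractions hb', e⟩
  · exact ⟨0, 0, Subring.zero_mem _, by simp⟩
  · exact ⟨0, 1, Subring.one_mem _, by simp⟩
  · rintro x y _ _ ⟨n, x', hx', e⟩ ⟨k, y', hy', e'⟩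
    refine ⟨n + k, c.res U.1 f ^ k * x' + c.res U.1 f ^ n * y', Subring.add_mem _
      (Subring.mul_mem _ (Subring.pow_mem _ (c.res_mem_ring U f) _) hx')
      (Subring.mul_mem _ (Subring.pow_mem _ (c.res_mem_ring U f) _) hy'), ?_⟩
    rw [map_add, map_mul _ _ x', map_mul _ _ y', ← e, ← e', pow_add, map_mul]
    ring
  · rintro x _ ⟨n, x', hx', e⟩
    exact ⟨n, -x', Subring.neg_mem _ hx', by rw [mul_neg, e, map_neg]⟩
  · rintro x y _ _ ⟨n, x', hx', e⟩ ⟨k, y', hy', e'⟩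
    refine ⟨n + k, x' * y', Subring.mul_mem _ hx' hy', ?_⟩
    rw [map_mul _ x' y', ← e, ← e', pow_add, map_mul]
    ring

/-- The presheaf of dilatation rings on the affine opens. -/
def diagram : X.AffineZariskiSiteᵒᵖ ⥤ CommRingCat.{u} where
  obj U := .of (c.ring U.unop)
  map {V U} i := CommRingCat.ofHom ((c.resLE (toOpens_mono i.unop.le)).restrict (c.ring V.unop)
    (c.ring U.unop) fun _ hb => c.resLE_mem_ring i.unop.le hb)
  map_id U := by
    ext x
    exact congrArg (fun φ : Γ(X, U.unop.1 ⊓ c.compl) ⟶ Γ(X, U.unop.1 ⊓ c.compl) => φ.hom x.1)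
      (X.presheaf.map_id _)
  map_comp {U V W} i j := by
    ext x
    exact congrArg (fun φ : Γ(X, U.unop.1 ⊓ c.compl) ⟶ Γ(X, W.unop.1 ⊓ c.compl) => φ.hom x.1)
      (X.presheaf.map_comp (homOfLE (inf_le_inf_right _ (toOpens_mono i.unop.le))).op
        (homOfLE (inf_le_inf_right _ (toOpens_mono j.unop.le))).op)

/-- The structure map from the structure presheaf to the dilatation rings. -/
def diagramMap : (toOpensFunctor X).op ⋙ X.presheaf ⟶ c.diagram where
  app U := CommRingCat.ofHom ((c.res U.unop.1).codRestrict (c.ring U.unop)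
    (c.res_mem_ring U.unop))
  naturality {V U} i := by
    ext a
    exact Subtype.ext (c.resLE_res (toOpens_mono i.unop.le) a).symm

lemma isLocalization_diagram (U : X.AffineZariskiSite) (f : Γ(X, U.1)) :
    letI := (((c.resLE (toOpens_mono (U.basicOpen_le f))).restrict (c.ring U)
      (c.ring (U.basicOpen f)) fun _ hb => c.resLE_mem_ring (U.basicOpen_le f) hb)).toAlgebra
    IsLocalization.Away (⟨c.res U.1 f, c.res_mem_ring U f⟩ : c.ring U)
      (c.ring (U.basicOpen f)) := by
  let := (((c.resLE (toOpens_mono (U.basicOpen_le f))).restrict (c.ring U)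
      (c.ring (U.basicOpen f)) fun _ hb => c.resLE_mem_ring (U.basicOpen_le f) hb)).toAlgebra
  let φ : c.ring U := ⟨c.res U.1 f, c.res_mem_ring U f⟩
  have hφ (x : c.ring U) : (algebraMap (c.ring U) (c.ring (U.basicOpen f)) x).1 =
    c.resLE (toOpens_mono (U.basicOpen_le f)) x.1 := rfl
  refine ⟨⟨?_, ?_, ?_⟩⟩
  · rintro ⟨_, n, rfl⟩
    have h1 : IsUnit ((X.presheaf.map (homOfLE (toOpens_mono (U.basicOpen_le f))).op).hom f) :=
      RingedSpace.isUnit_res_basicOpen _ f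
    obtain ⟨g, hg⟩ := h1.exists_right_inv
    have h2 : algebraMap (c.ring U) (c.ring (U.basicOpen f)) φ *
        ⟨c.res _ g, c.res_mem_ring (U.basicOpen f) g⟩ = 1 := by
      refine Subtype.ext ?_
      change c.resLE _ (c.res U.1 f) * c.res (U.basicOpen f).1 g = 1
      rw [c.resLE_res, ← map_mul, hg, map_one]
    change IsUnit (algebraMap (c.ring U) (c.ring (U.basicOpen f)) (φ ^ n))
    rw [map_pow]
    exact (IsUnit.of_mul_eq_one _ h2).pow n
  · rintro ⟨z, hz⟩
    obtain ⟨n, b, hb, e⟩ := c.exists_mem_ring U f hz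
    exact ⟨(⟨b, hb⟩, ⟨φ ^ n, n, rfl⟩), Subtype.ext ((mul_comm _ _).trans e)⟩
  · rintro x y e
    have e' : c.resLE (toOpens_mono (U.basicOpen_le f)) (x.1 - y.1) = 0 := by
      rw [map_sub, sub_eq_zero]
      exact congrArg Subtype.val e
    obtain ⟨n, hn⟩ := c.exists_pow_mul_eq_zero U f _ e'
    refine ⟨⟨φ ^ n, n, rfl⟩, Subtype.ext ?_⟩
    change c.res U.1 f ^ n * x.1 = c.res U.1 f ^ n * y.1
    linear_combination hn

lemma coequifibered_diagramMap : c.diagramMap.Coequifibered :=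
  coequifibered_iff_forall_isLocalizationAway.mpr fun U f ↦ c.isLocalization_diagram U f

/-- The spectra of the dilatation rings, as a family of schemes to be glued over `X`. -/
def glueData : (directedCover X).RelativeGluingData :=
  relativeGluingData c.coequifibered_diagramMap

instance : (c.glueData.functor ⋙ Scheme.forget).IsLocallyDirected :=
  Cover.RelativeGluingData.instIsLocallyDirectedI₀CompFunctorForgetOfIsThin ..

/-- The dilatation of `X` with multi-center `c`: the `X`-affine scheme obtained by gluing the
spectra of the dilatation rings. -/
def dilatation : Scheme.{u} := c.glueData.glued

/-- The dilatation map. -/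
def dilatationMap : c.dilatation ⟶ X := c.glueData.toBase

/-- The canonical open immersion of the spectrum of a dilatation ring. -/
def chart (U : X.AffineZariskiSite) : Spec (.of (c.ring U)) ⟶ c.dilatation :=
  c.glueData.cover.f U

instance (U : X.AffineZariskiSite) : IsOpenImmersion (c.chart U) :=
  c.glueData.cover.map_prop U

/-- Restriction of dilatation rings. -/
def ringRes {U V : X.AffineZariskiSite} (h : U ≤ V) : c.ring V →+* c.ring U :=
  (c.resLE (toOpens_mono h)).restrict (c.ring V) (c.ring U) fun _ hb => c.resLE_mem_ring h hb

/-- The structure map to a dilatation ring. -/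
def toRing (U : X.AffineZariskiSite) : Γ(X, U.1) →+* c.ring U :=
  (c.res U.1).codRestrict (c.ring U) (c.res_mem_ring U)

lemma chart_ringRes {U V : X.AffineZariskiSite} (h : U ≤ V) :
    Spec.map (CommRingCat.ofHom (c.ringRes h)) ≫ c.chart V = c.chart U :=
  colimit.w c.glueData.functor (homOfLE h)

lemma chart_dilatationMap (U : X.AffineZariskiSite) :
    c.chart U ≫ c.dilatationMap = Spec.map (CommRingCat.ofHom (c.toRing U)) ≫ U.2.fromSpec :=
  colimit.ι_desc _ _

lemma preimage_dilatationMap (U : X.AffineZariskiSite) :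
    c.dilatationMap ⁻¹ᵁ U.1 = (c.chart U).opensRange := by
  have := c.glueData.toBase_preimage_eq_opensRange_ι U
  rwa [show ((directedCover X).f U).opensRange = U.1 from Scheme.Opens.opensRange_ι _] at this

/-- The cover of an `X`-scheme by the preimages of the affine opens of `X`. -/
def preimageCover {T X : Scheme.{u}} (f : T ⟶ X) : T.OpenCover where
  I₀ := X.AffineZariskiSite
  X U := (f ⁻¹ᵁ U.1).toScheme
  f U := (f ⁻¹ᵁ U.1).ι
  mem₀ := by
    rw [presieve₀_mem_precoverage_iff]
    refine ⟨fun x ↦ ?_, fun U => inferInstanceAs (IsOpenImmersion (f ⁻¹ᵁ U.1).ι)⟩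
    obtain ⟨U, hxU⟩ := TopologicalSpace.Opens.mem_iSup.mp
      ((iSup_affineOpens_eq_top X).ge (Set.mem_univ (f x)))
    exact ⟨⟨U.1, U.2⟩, ⟨x, hxU⟩, rfl⟩

instance {T X : Scheme.{u}} (f : T ⟶ X) : Category (preimageCover f).I₀ :=
  inferInstanceAs (Category X.AffineZariskiSite)

instance {T X : Scheme.{u}} (f : T ⟶ X) : (preimageCover f).LocallyDirected where
  trans {U V} i := T.homOfLE (f.preimage_mono (toOpens_mono i.1.1))
  trans_id U := T.homOfLE_rfl _
  trans_comp {U V W} i j := (T.homOfLE_homOfLE _ _).symm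
  w {U V} i := T.homOfLE_ι _
  directed {U V} x := by
    let p : pullback ((preimageCover f).f U) ((preimageCover f).f V) ⟶ T :=
      pullback.fst _ _ ≫ (preimageCover f).f U
    have haU : f (p x) ∈ U.1 := (pullback.fst ((preimageCover f).f U) ((preimageCover f).f V) x).2
    have haV : f (p x) ∈ V.1 := by
      have : p = pullback.snd _ _ ≫ (preimageCover f).f V := pullback.condition
      rw [this]
      exact (pullback.snd ((preimageCover f).f U) ((preimageCover f).f V) x).2
    obtain ⟨a, b, e, hxa⟩ := exists_basicOpen_le_affine_inter U.2 V.2 _ ⟨haU, haV⟩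
    let W : X.AffineZariskiSite := AffineZariskiSite.basicOpen U a
    have h1 : W ≤ U := U.basicOpen_le a
    have h2 : W ≤ V := ⟨b, e.symm⟩
    refine ⟨W, homOfLE (X := X.AffineZariskiSite) h1, homOfLE (X := X.AffineZariskiSite) h2, ⟨p x, hxa⟩, ?_⟩
    apply p.isOpenEmbedding.injective
    have h3 : pullback.lift (f := (preimageCover f).f U) (g := (preimageCover f).f V)
        (T.homOfLE (f.preimage_mono (toOpens_mono h1)))
        (T.homOfLE (f.preimage_mono (toOpens_mono h2)))
        ((T.homOfLE_ι _).trans (T.homOfLE_ι _).symm) ≫ p = (f ⁻¹ᵁ W.1).ι :=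
      (pullback.lift_fst_assoc _ _ _ _).trans (T.homOfLE_ι _)
    exact congrArg (fun g : (f ⁻¹ᵁ W.1).toScheme ⟶ T => g ⟨p x, hxa⟩) h3
  property_trans {U V} i := inferInstanceAs (IsOpenImmersion (T.homOfLE _))

/-- The restriction to the preimage of an affine open `U` of the morphism to the dilatation given
by a homomorphism from the dilatation ring over `U`. -/
def liftChart {T : Scheme.{u}} (f : T ⟶ X)
    (φ : ∀ U : X.AffineZariskiSite, c.ring U →+* Γ(T, f ⁻¹ᵁ U.1)) (U : X.AffineZariskiSite) :
    (f ⁻¹ᵁ U.1).toScheme ⟶ c.dilatation :=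
  (f ⁻¹ᵁ U.1).toSpecΓ ≫ Spec.map (CommRingCat.ofHom (φ U)) ≫ c.chart U

lemma homOfLE_liftChart {T : Scheme.{u}} (f : T ⟶ X)
    (φ : ∀ U : X.AffineZariskiSite, c.ring U →+* Γ(T, f ⁻¹ᵁ U.1))
    (hφ : ∀ {U V : X.AffineZariskiSite} (h : U ≤ V) (b : c.ring V), φ U (c.ringRes h b) =
      (T.presheaf.map (homOfLE (f.preimage_mono (toOpens_mono h))).op).hom (φ V b))
    {U V : X.AffineZariskiSite} (h : U ≤ V) :
    T.homOfLE (f.preimage_mono (toOpens_mono h)) ≫ c.liftChart f φ V = c.liftChart f φ U := by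
  have h1 := Scheme.Opens.toSpecΓ_SpecMap_presheaf_map _ _ (f.preimage_mono (toOpens_mono h))
  have h2 : CommRingCat.ofHom (c.ringRes h) ≫ CommRingCat.ofHom (φ U) =
      CommRingCat.ofHom (φ V) ≫
        T.presheaf.map (homOfLE (f.preimage_mono (toOpens_mono h))).op := by
    ext b
    exact hφ h b
  unfold liftChart
  rw [← c.chart_ringRes h, ← Spec.map_comp_assoc, h2, Spec.map_comp_assoc]
  have h3 := congrArg (· ≫ Spec.map (CommRingCat.ofHom (φ V)) ≫ c.chart V) h1
  simpa only [Category.assoc] using h3.symm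

/-- The `X`-morphism to the dilatation that is given by compatible homomorphisms from the
dilatation rings. -/
def lift {T : Scheme.{u}} (f : T ⟶ X)
    (φ : ∀ U : X.AffineZariskiSite, c.ring U →+* Γ(T, f ⁻¹ᵁ U.1))
    (hφ : ∀ {U V : X.AffineZariskiSite} (h : U ≤ V) (b : c.ring V), φ U (c.ringRes h b) =
      (T.presheaf.map (homOfLE (f.preimage_mono (toOpens_mono h))).op).hom (φ V b)) :
    T ⟶ c.dilatation :=
  Scheme.OpenCover.glueMorphismsOfLocallyDirected (preimageCover f) (c.liftChart f φ)
    fun {U V : X.AffineZariskiSite} (i : U ⟶ V) ↦ c.homOfLE_liftChart f φ hφ i.le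

lemma ι_lift {T : Scheme.{u}} (f : T ⟶ X)
    (φ : ∀ U : X.AffineZariskiSite, c.ring U →+* Γ(T, f ⁻¹ᵁ U.1))
    (hφ : ∀ {U V : X.AffineZariskiSite} (h : U ≤ V) (b : c.ring V), φ U (c.ringRes h b) =
      (T.presheaf.map (homOfLE (f.preimage_mono (toOpens_mono h))).op).hom (φ V b))
    (U : X.AffineZariskiSite) : (f ⁻¹ᵁ U.1).ι ≫ c.lift f φ hφ = c.liftChart f φ U :=
  Scheme.OpenCover.map_glueMorphismsOfLocallyDirected (preimageCover f) _
    (fun {U V : X.AffineZariskiSite} (i : U ⟶ V) ↦ c.homOfLE_liftChart f φ hφ i.le) U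

lemma isAffineOpen_preimage_dilatationMap (U : X.AffineZariskiSite) :
    IsAffineOpen (c.dilatationMap ⁻¹ᵁ U.1) := by
  rw [c.preimage_dilatationMap U]
  exact isAffineOpen_opensRange (c.chart U)

/-- The preimage of an affine open under the dilatation map is the spectrum of the dilatation
ring. -/
def preimageIso (U : X.AffineZariskiSite) :
    (c.dilatationMap ⁻¹ᵁ U.1).toScheme ≅ Spec (.of (c.ring U)) :=
  IsOpenImmersion.isoOfRangeEq (c.dilatationMap ⁻¹ᵁ U.1).ι (c.chart U)
    (by simpa using congrArg (fun W : c.dilatation.Opens => (W : Set c.dilatation))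
          (c.preimage_dilatationMap U))

lemma preimageIso_hom_chart (U : X.AffineZariskiSite) :
    (c.preimageIso U).hom ≫ c.chart U = (c.dilatationMap ⁻¹ᵁ U.1).ι :=
  IsOpenImmersion.isoOfRangeEq_hom_fac _ _ _

/-- The homomorphism from the dilatation ring to the functions on the dilatation. -/
def toΓ (U : X.AffineZariskiSite) : c.ring U →+* Γ(c.dilatation, c.dilatationMap ⁻¹ᵁ U.1) :=
  (Spec.preimage ((c.isAffineOpen_preimage_dilatationMap U).isoSpec.inv ≫
    (c.preimageIso U).hom)).hom

lemma toSpecΓ_toΓ (U : X.AffineZariskiSite) :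
    (c.dilatationMap ⁻¹ᵁ U.1).toSpecΓ ≫ Spec.map (CommRingCat.ofHom (c.toΓ U)) =
      (c.preimageIso U).hom := by
  have h : Spec.map (CommRingCat.ofHom (c.toΓ U)) =
      (c.isAffineOpen_preimage_dilatationMap U).isoSpec.inv ≫ (c.preimageIso U).hom :=
    Spec.map_preimage _
  rw [h]
  exact (c.isAffineOpen_preimage_dilatationMap U).isoSpec.hom_inv_id_assoc _

lemma toΓ_ringRes {U V : X.AffineZariskiSite} (h : U ≤ V) (b : c.ring V) :
    c.toΓ U (c.ringRes h b) = (c.dilatation.presheaf.map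
      (homOfLE (c.dilatationMap.preimage_mono (toOpens_mono h))).op).hom (c.toΓ V b) := by
  have hU := c.isAffineOpen_preimage_dilatationMap U
  have h1 : (c.dilatationMap ⁻¹ᵁ U.1).toSpecΓ ≫
      Spec.map (CommRingCat.ofHom (c.ringRes h) ≫ CommRingCat.ofHom (c.toΓ U)) =
      (c.dilatationMap ⁻¹ᵁ U.1).toSpecΓ ≫ Spec.map (CommRingCat.ofHom (c.toΓ V) ≫
        c.dilatation.presheaf.map
          (homOfLE (c.dilatationMap.preimage_mono (toOpens_mono h))).op) := by
    have h2 := Scheme.Opens.toSpecΓ_SpecMap_presheaf_map _ _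
      (c.dilatationMap.preimage_mono (toOpens_mono h))
    rw [Spec.map_comp, Spec.map_comp, ← Category.assoc, c.toSpecΓ_toΓ, ← cancel_mono (c.chart V),
      Category.assoc, c.chart_ringRes h, c.preimageIso_hom_chart]
    have h3 := congrArg (· ≫ Spec.map (CommRingCat.ofHom (c.toΓ V)) ≫ c.chart V) h2
    refine Eq.trans ?_ ((h3.symm.trans ?_))
    · have h4 := congrArg (· ≫ c.chart V) (c.toSpecΓ_toΓ V)
      simp only [Category.assoc] at h4 ⊢
      refine Eq.symm ?_
      refine (congrArg (_ ≫ ·) (h4.trans (c.preimageIso_hom_chart V))).trans ?_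
      exact c.dilatation.homOfLE_ι _
    · simp only [Category.assoc]
  have h5 : IsIso (c.dilatationMap ⁻¹ᵁ U.1).toSpecΓ := inferInstanceAs (IsIso hU.isoSpec.hom)
  have h6 := Spec.map_injective ((cancel_epi _).mp h1)
  exact congrArg (fun φ : CommRingCat.of (c.ring V) ⟶
    Γ(c.dilatation, c.dilatationMap ⁻¹ᵁ U.1) => φ.hom b) h6

lemma mem_compl_iff (x : X) : x ∈ c.compl ↔ ∀ i, x ∉ (c.divisor i).support := by
  have h (s : Finset ι) : x ∈ (∏ i ∈ s, c.divisor i).support ↔ ∃ i ∈ s, x ∈ (c.divisor i).support := by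
    classical
    induction s using Finset.induction_on with
    | empty =>
      simp only [Finset.prod_empty, IdealSheafData.one_eq_top, IdealSheafData.support_top,
        Finset.notMem_empty, false_and, exists_false, iff_false]
      exact fun h => h
    | insert a s ha ih =>
      rw [Finset.prod_insert ha, IdealSheafData.support_mul]
      simp only [Finset.mem_insert, exists_eq_or_imp, ← ih]
      exact Iff.rfl
  change x ∉ (∏ i, c.divisor i).support ↔ _
  rw [h]
  simp

/-- Multi-centers `c'` on `X'` and `c` on `X` are compatible with a morphism `g : X' ⟶ X` if `g`
maps the centers of `c'` to the centers of `c`, and the divisors of `c'` contain the preimages of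
the divisors of `c`. -/
structure MapsTo {X' : Scheme.{u}} (c' : X'.Multicenter ι) (c : X.Multicenter ι) (g : X' ⟶ X) :
    Prop where
  center_le : ∀ i, (c.center i).comap g ≤ c'.center i
  divisor_le : ∀ i, c'.divisor i ≤ (c.divisor i).comap g

variable {c}
variable {X' : Scheme.{u}} {c' : X'.Multicenter ι} {g : X' ⟶ X}

lemma MapsTo.inf_compl_le (h : MapsTo c' c g) (U : X.Opens) :
    g ⁻¹ᵁ U ⊓ c'.compl ≤ g ⁻¹ᵁ (U ⊓ c.compl) := by
  rintro x ⟨hxU, hx⟩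
  refine ⟨hxU, ?_⟩
  change g x ∈ c.compl
  rw [mem_compl_iff]
  intro i hi
  have h1 : x ∈ ((c.divisor i).comap g).support := by
    rw [IdealSheafData.support_comap]
    exact hi
  exact (mem_compl_iff c' x).mp hx i (IdealSheafData.support_antitone (h.divisor_le i) h1)

/-- The homomorphism between the sections outside of the divisors. -/
def MapsTo.sectionsMap (h : MapsTo c' c g) (U : X.Opens) :
    Γ(X, U ⊓ c.compl) →+* Γ(X', g ⁻¹ᵁ U ⊓ c'.compl) :=
  (g.appLE _ _ (h.inf_compl_le U)).hom

lemma MapsTo.sectionsMap_res (h : MapsTo c' c g) (U : X.Opens) (a : Γ(X, U)) :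
    h.sectionsMap U (c.res U a) = c'.res (g ⁻¹ᵁ U) ((g.app U).hom a) := by
  have e : X.presheaf.map (homOfLE (inf_le_left : U ⊓ c.compl ≤ U)).op ≫
      g.appLE _ _ (h.inf_compl_le U) =
      g.app U ≫ X'.presheaf.map (homOfLE (inf_le_left : g ⁻¹ᵁ U ⊓ c'.compl ≤ _)).op := by
    rw [Hom.map_appLE]
    rfl
  exact congrArg (fun φ : Γ(X, U) ⟶ Γ(X', g ⁻¹ᵁ U ⊓ c'.compl) => φ.hom a) e

lemma MapsTo.sectionsMap_resLE (h : MapsTo c' c g) {U V : X.Opens} (hUV : U ≤ V)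
    (b : Γ(X, V ⊓ c.compl)) : h.sectionsMap U (c.resLE hUV b) =
      c'.resLE (g.preimage_mono hUV) (h.sectionsMap V b) := by
  have e : X.presheaf.map (homOfLE (inf_le_inf_right c.compl hUV)).op ≫
      g.appLE _ _ (h.inf_compl_le U) = g.appLE _ _ (h.inf_compl_le V) ≫
      X'.presheaf.map (homOfLE (inf_le_inf_right c'.compl (g.preimage_mono hUV))).op := by
    rw [Hom.map_appLE, Hom.appLE_map]
  exact congrArg (fun φ : Γ(X, V ⊓ c.compl) ⟶ Γ(X', g ⁻¹ᵁ U ⊓ c'.compl) => φ.hom b) e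

/-- The preimage of an affine open under an affine morphism. -/
def preimageSite (g : X' ⟶ X) [IsAffineHom g] (U : X.AffineZariskiSite) : X'.AffineZariskiSite :=
  ⟨g ⁻¹ᵁ U.1, U.2.preimage g⟩

lemma preimageSite_mono (g : X' ⟶ X) [IsAffineHom g] {U V : X.AffineZariskiSite} (h : U ≤ V) :
    preimageSite g U ≤ preimageSite g V := by
  obtain ⟨f, hf⟩ := h
  exact ⟨(g.app V.1).hom f,
    (Scheme.preimage_basicOpen g f).symm.trans (congrArg (g ⁻¹ᵁ ·) hf)⟩

lemma exists_mem_of_mem_span {R T : Type u} [CommRing R] [CommRing T] (ρ : R →+* T) (b : T)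
    {s : Set R} {M : Ideal R} (hs : ∀ x ∈ s, ∃ m ∈ M, ρ x * b = ρ m) {a : R}
    (ha : a ∈ Ideal.span s) : ∃ m ∈ M, ρ a * b = ρ m := by
  refine Submodule.span_induction hs ?_ ?_ ?_ ha
  · exact ⟨0, Ideal.zero_mem _, by simp⟩
  · rintro x y _ _ ⟨m, hm, e⟩ ⟨n, hn, e'⟩
    exact ⟨m + n, Ideal.add_mem _ hm hn, by rw [map_add, add_mul, e, e', map_add]⟩
  · rintro r x _ ⟨m, hm, e⟩
    exact ⟨r * m, Ideal.mul_mem_left _ _ hm, by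
      rw [smul_eq_mul, map_mul, mul_assoc, e, map_mul]⟩

lemma MapsTo.sectionsMap_mem_fractions [IsAffineHom g] (h : MapsTo c' c g)
    (U : X.AffineZariskiSite) {i : ι} {b : Γ(X, U.1 ⊓ c.compl)} (hb : b ∈ c.fractions U i) :
    h.sectionsMap U.1 b ∈ c'.fractions (preimageSite g U) i := by
  have hc (J : X.IdealSheafData) : (J.comap g).ideal ⟨g ⁻¹ᵁ U.1, U.2.preimage g⟩ =
      (J.ideal ⟨U.1, U.2⟩).map (g.app U.1).hom := by
    rw [J.ideal_comap g ⟨U.1, U.2⟩ ⟨g ⁻¹ᵁ U.1, U.2.preimage g⟩ le_rfl, Hom.app_eq_appLE]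
  intro (a : Γ(X', g ⁻¹ᵁ U.1)) ha
  have ha' : a ∈ ((c.divisor i).ideal ⟨U.1, U.2⟩).map (g.app U.1).hom :=
    (hc (c.divisor i)).le (h.divisor_le i ⟨g ⁻¹ᵁ U.1, U.2.preimage g⟩ ha)
  have hM : ∀ m ∈ (c.center i).ideal ⟨U.1, U.2⟩,
      (g.app U.1).hom m ∈ (c'.center i).ideal ⟨g ⁻¹ᵁ U.1, U.2.preimage g⟩ := fun m hm =>
    h.center_le i ⟨g ⁻¹ᵁ U.1, U.2.preimage g⟩
      ((hc (c.center i)).symm ▸ Ideal.mem_map_of_mem _ hm)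
  refine exists_mem_of_mem_span (c'.res (g ⁻¹ᵁ U.1)) (h.sectionsMap U.1 b) ?_ ha'
  rintro _ ⟨x, hx, rfl⟩
  obtain ⟨m, hm, e⟩ := hb x hx
  refine ⟨_, hM m hm, ?_⟩
  exact (congrArg (· * _) (h.sectionsMap_res U.1 x).symm).trans
    ((map_mul _ _ _).symm.trans ((congrArg _ e).trans (h.sectionsMap_res U.1 m)))

lemma MapsTo.sectionsMap_mem_ring [IsAffineHom g] (h : MapsTo c' c g)
    (U : X.AffineZariskiSite) {b : Γ(X, U.1 ⊓ c.compl)} (hb : b ∈ c.ring U) :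
    h.sectionsMap U.1 b ∈ c'.ring (preimageSite g U) := by
  suffices c.ring U ≤ (c'.ring (preimageSite g U)).comap (h.sectionsMap U.1) from this hb
  refine Subring.closure_le.mpr ?_
  rintro _ (⟨a, rfl⟩ | hb)
  · exact (congrArg (· ∈ c'.ring (preimageSite g U)) (h.sectionsMap_res U.1 a)).mpr
      (c'.res_mem_ring (preimageSite g U) _)
  · obtain ⟨i, hb⟩ := Set.mem_iUnion.mp hb
    exact c'.mem_ring_of_mem_fractions (h.sectionsMap_mem_fractions U hb)

/-- The homomorphism between dilatation rings; it sends `m / a` to `g(m) / g(a)`. -/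
def MapsTo.ringMap [IsAffineHom g] (h : MapsTo c' c g) (U : X.AffineZariskiSite) :
    c.ring U →+* c'.ring (preimageSite g U) :=
  (h.sectionsMap U.1).restrict (c.ring U) (c'.ring (preimageSite g U))
    fun _ hb => h.sectionsMap_mem_ring U hb

lemma MapsTo.ringMap_ringRes [IsAffineHom g] (h : MapsTo c' c g) {U V : X.AffineZariskiSite}
    (hUV : U ≤ V) (b : c.ring V) : h.ringMap U (c.ringRes hUV b) =
      c'.ringRes (preimageSite_mono g hUV) (h.ringMap V b) :=
  Subtype.ext (h.sectionsMap_resLE (toOpens_mono hUV) b.1)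

lemma MapsTo.toΓ_ringMap [IsAffineHom g] (h : MapsTo c' c g) {U V : X.AffineZariskiSite}
    (hUV : U ≤ V) (b : c.ring V) :
    ((c'.toΓ (preimageSite g U)).comp (h.ringMap U)) (c.ringRes hUV b) =
      (c'.dilatation.presheaf.map (homOfLE ((c'.dilatationMap ≫ g).preimage_mono
        (toOpens_mono hUV))).op).hom (((c'.toΓ (preimageSite g V)).comp (h.ringMap V)) b) :=
  (congrArg _ (h.ringMap_ringRes hUV b)).trans
      (c'.toΓ_ringRes (preimageSite_mono g hUV) (h.ringMap V b))

/-- The morphism between dilatations over an affine morphism `g`. -/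
def MapsTo.map [IsAffineHom g] (h : MapsTo c' c g) : c'.dilatation ⟶ c.dilatation :=
  c.lift (c'.dilatationMap ≫ g) (fun U => (c'.toΓ (preimageSite g U)).comp (h.ringMap U))
    h.toΓ_ringMap

lemma MapsTo.ι_map [IsAffineHom g] (h : MapsTo c' c g) (U : X.AffineZariskiSite) :
    (c'.dilatationMap ⁻¹ᵁ (preimageSite g U).1).ι ≫ h.map =
      (c'.preimageIso (preimageSite g U)).hom ≫
        Spec.map (CommRingCat.ofHom (h.ringMap U)) ≫ c.chart U := by
  refine (c.ι_lift (c'.dilatationMap ≫ g)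
    (fun U => (c'.toΓ (preimageSite g U)).comp (h.ringMap U)) h.toΓ_ringMap U).trans ?_
  have h1 := c'.toSpecΓ_toΓ (preimageSite g U)
  have h2 : Spec.map (CommRingCat.ofHom ((c'.toΓ (preimageSite g U)).comp (h.ringMap U))) =
      Spec.map (CommRingCat.ofHom (c'.toΓ (preimageSite g U))) ≫
        Spec.map (CommRingCat.ofHom (h.ringMap U)) :=
    Spec.map_comp (CommRingCat.ofHom (h.ringMap U)) (CommRingCat.ofHom (c'.toΓ (preimageSite g U)))
  have h3 := congrArg (fun z => (c'.dilatationMap ⁻¹ᵁ (preimageSite g U).1).toSpecΓ ≫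
    z ≫ c.chart U) h2
  refine h3.trans ?_
  have h4 := congrArg (· ≫ Spec.map (CommRingCat.ofHom (h.ringMap U)) ≫ c.chart U) h1
  refine Eq.trans ?_ h4
  simp only [Category.assoc]

lemma MapsTo.chart_map [IsAffineHom g] (h : MapsTo c' c g) (U : X.AffineZariskiSite) :
    c'.chart (preimageSite g U) ≫ h.map =
      Spec.map (CommRingCat.ofHom (h.ringMap U)) ≫ c.chart U := by
  rw [← cancel_epi (c'.preimageIso (preimageSite g U)).hom, ← Category.assoc,
    c'.preimageIso_hom_chart, h.ι_map]

lemma hom_ext_chart [IsAffineHom g] {Z : Scheme.{u}} {p q : c'.dilatation ⟶ Z}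
    (h : ∀ U : X.AffineZariskiSite,
      c'.chart (preimageSite g U) ≫ p = c'.chart (preimageSite g U) ≫ q) : p = q := by
  refine Scheme.Cover.hom_ext (preimageCover (c'.dilatationMap ≫ g)) _ _ fun U => ?_
  have h1 := c'.preimageIso_hom_chart (preimageSite g U)
  have h2 := congrArg ((c'.preimageIso (preimageSite g U)).hom ≫ ·) (h U)
  simp only [← Category.assoc, h1] at h2
  exact h2

lemma MapsTo.map_dilatationMap [IsAffineHom g] (h : MapsTo c' c g) :
    h.map ≫ c.dilatationMap = c'.dilatationMap ≫ g := by
  refine hom_ext_chart (g := g) fun U => ?_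
  have h2 : CommRingCat.ofHom (c.toRing U) ≫ CommRingCat.ofHom (h.ringMap U) =
      g.app U.1 ≫ CommRingCat.ofHom (c'.toRing (preimageSite g U)) := by
    ext a
    exact h.sectionsMap_res U.1 a
  have h3 := IsAffineOpen.SpecMap_appLE_fromSpec g U.2 (U.2.preimage g) le_rfl
  rw [← Hom.app_eq_appLE] at h3
  calc c'.chart (preimageSite g U) ≫ h.map ≫ c.dilatationMap
      = Spec.map (CommRingCat.ofHom (c.toRing U) ≫ CommRingCat.ofHom (h.ringMap U)) ≫
          IsAffineOpen.fromSpec U.2 := by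
        rw [← Category.assoc, h.chart_map, Category.assoc, c.chart_dilatationMap, Spec.map_comp,
          Category.assoc]
    _ = Spec.map (CommRingCat.ofHom (c'.toRing (preimageSite g U))) ≫
          Spec.map (g.app U.1) ≫ IsAffineOpen.fromSpec U.2 := by
        rw [h2, Spec.map_comp, Category.assoc]
        rfl
    _ = (Spec.map (CommRingCat.ofHom (c'.toRing (preimageSite g U))) ≫
          IsAffineOpen.fromSpec (U.2.preimage g)) ≫ g :=
        (congrArg (_ ≫ ·) h3).trans (Category.assoc _ _ _).symm
    _ = (c'.chart (preimageSite g U) ≫ c'.dilatationMap) ≫ g :=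
        congrArg (· ≫ g) (c'.chart_dilatationMap (preimageSite g U)).symm
    _ = _ := Category.assoc _ _ _

lemma MapsTo.map_comp {X'' : Scheme.{u}} {c'' : X''.Multicenter ι} {g' : X'' ⟶ X'}
    {g'' : X'' ⟶ X} [IsAffineHom g] [IsAffineHom g'] [IsAffineHom g''] (h : MapsTo c' c g)
    (h' : MapsTo c'' c' g') (h'' : MapsTo c'' c g'') (e : g' ≫ g = g'') :
    h'.map ≫ h.map = h''.map := by
  subst e
  refine hom_ext_chart (g := g' ≫ g) fun U => ?_
  have h1 : CommRingCat.ofHom (h.ringMap U) ≫ CommRingCat.ofHom (h'.ringMap (preimageSite g U)) =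
      CommRingCat.ofHom (h''.ringMap U) := by
    ext b
    refine congrArg (fun φ : Γ(X, U.1 ⊓ c.compl) ⟶ Γ(X'', g' ⁻¹ᵁ (g ⁻¹ᵁ U.1) ⊓ c''.compl) =>
      φ.hom b.1) (Hom.appLE_comp_appLE _ _ _ _ _ (h.inf_compl_le U.1) (h'.inf_compl_le _))
  have h2 : c''.chart (preimageSite g' (preimageSite g U)) ≫ h'.map =
      Spec.map (CommRingCat.ofHom (h'.ringMap (preimageSite g U))) ≫ c'.chart (preimageSite g U) :=
    h'.chart_map (preimageSite g U)
  have h3 : Spec.map (CommRingCat.ofHom (h''.ringMap U)) =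
      Spec.map (CommRingCat.ofHom (h'.ringMap (preimageSite g U))) ≫
        Spec.map (CommRingCat.ofHom (h.ringMap U)) :=
    (congrArg Spec.map h1.symm).trans (Spec.map_comp _ _)
  refine Eq.trans ?_ (h''.chart_map U).symm
  refine Eq.trans ?_ (congrArg (· ≫ c.chart U) h3).symm
  refine (Category.assoc _ _ _).symm.trans ((congrArg (· ≫ h.map) h2).trans ?_)
  refine (Category.assoc _ _ _).trans ((congrArg (_ ≫ ·) (h.chart_map U)).trans ?_)
  exact (Category.assoc _ _ _).symm

end Multicenter
end Scheme

namespace Scheme.IdealSheafData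

variable {X Y : Scheme.{u}}

lemma comap_mul_le (J J' : Y.IdealSheafData) (f : X ⟶ Y) :
    J.comap f * J'.comap f ≤ (J * J').comap f := by
  have h (x : X) : ∃ (U : Y.affineOpens) (V : X.affineOpens), x ∈ V.1 ∧ V.1 ≤ f ⁻¹ᵁ U.1 := by
    obtain ⟨U, hxU⟩ := TopologicalSpace.Opens.mem_iSup.mp
      ((iSup_affineOpens_eq_top Y).ge (Set.mem_univ (f x)))
    obtain ⟨_, ⟨V, hV, rfl⟩, hxV, hVU⟩ :=
      X.isBasis_affineOpens.exists_subset_of_mem_open (show x ∈ f ⁻¹ᵁ U.1 from hxU) (f ⁻¹ᵁ U.1).2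
    exact ⟨U, ⟨V, hV⟩, hxV, hVU⟩
  choose U V hV hVU using h
  refine le_of_iSup_eq_top V ?_ fun x => ?_
  · exact top_le_iff.mp fun x _ => TopologicalSpace.Opens.mem_iSup.mpr ⟨x, hV x⟩
  · rw [ideal_comap _ f (U x) (V x) (hVU x), ideal_mul, ideal_mul, Pi.mul_apply, Pi.mul_apply,
      ideal_comap _ f (U x) (V x) (hVU x), ideal_comap _ f (U x) (V x) (hVU x), Ideal.map_mul]

lemma prod_comap_le {ι : Type*} (s : Finset ι) (J : ι → Y.IdealSheafData) (f : X ⟶ Y) :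
    ∏ i ∈ s, (J i).comap f ≤ (∏ i ∈ s, J i).comap f := by
  classical
  induction s using Finset.induction_on with
  | empty =>
    simp only [Finset.prod_empty, one_eq_top, comap_top]
    exact le_rfl
  | insert a s ha ih =>
    rw [Finset.prod_insert ha, Finset.prod_insert ha]
    exact (mul_le_mul_right ih _).trans (comap_mul_le _ _ f)

end Scheme.IdealSheafData

/-- A deformation datum on `X` indexed by a totally ordered set `I`: a decreasing family of closed
subschemes `X i` (given by an increasing family of quasi-coherent ideals) and a family of locally
principal closed subschemes `D i`. -/
structure DeformationDatum (X : Scheme.{u}) (I : Type v) [LinearOrder I] where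
  center : I → X.IdealSheafData
  divisor : I → X.IdealSheafData
  monotone_center : Monotone center
  isLocallyPrincipal : ∀ i, (divisor i).IsLocallyPrincipal

namespace DeformationDatum

variable {X : Scheme.{u}} {I : Type v} [LinearOrder I]

/-- The multi-center with centers `X i` and divisors `∑ j ≥ i, D j`. (The sum of closed subschemes
is given by the product of ideals.) -/
def multicenter [Fintype I] (d : DeformationDatum X I) : X.Multicenter I where
  center := d.center
  divisor i := ∏ j with i ≤ j, d.divisor j
  isLocallyPrincipal _ := .prod _ fun j _ => d.isLocallyPrincipal j

/-- The deformation space `𝔻((D i over X i) i, X)`. -/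
def space [Fintype I] (d : DeformationDatum X I) : Scheme.{u} := d.multicenter.dilatation

/-- The dilatation map from the deformation space to `X`. -/
def toBase [Fintype I] (d : DeformationDatum X I) : d.space ⟶ X := d.multicenter.dilatationMap

/-- The deformation datum indexed by a subset `S` of `I`. -/
def restrict (d : DeformationDatum X I) (S : Finset I) : DeformationDatum X S where
  center s := d.center s
  divisor s := d.divisor s
  monotone_center _ _ h := d.monotone_center h
  isLocallyPrincipal s := d.isLocallyPrincipal s

/-- The pullback of a deformation datum along a morphism. -/
def pullback {Y : Scheme.{u}} (d : DeformationDatum X I) (f : Y ⟶ X) : DeformationDatum Y I where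
  center i := (d.center i).comap f
  divisor i := (d.divisor i).comap f
  monotone_center _ _ h := Scheme.IdealSheafData.comap_mono f (d.monotone_center h)
  isLocallyPrincipal i := (d.isLocallyPrincipal i).comap f

lemma mapsTo_pullback [Fintype I] {Y : Scheme.{u}} (d : DeformationDatum X I) (f : Y ⟶ X) :
    Scheme.Multicenter.MapsTo (d.pullback f).multicenter d.multicenter f where
  center_le _ := le_rfl
  divisor_le _ := Scheme.IdealSheafData.prod_comap_le _ _ f

lemma mapsTo_pullback_pullback [Fintype I] {Y Z : Scheme.{u}} (d : DeformationDatum X I)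
    (f : Y ⟶ X) (g : Z ⟶ Y) (h : Z ⟶ X) (e : g ≫ f = h) :
    Scheme.Multicenter.MapsTo (d.pullback h).multicenter (d.pullback f).multicenter g where
  center_le i := ((d.center i).comap_comp g f).symm.le.trans (by rw [e]; exact le_rfl)
  divisor_le _ := by
    subst e
    refine le_trans (le_of_eq ?_) (Scheme.IdealSheafData.prod_comap_le _ _ g)
    exact Finset.prod_congr rfl fun j _ => (d.divisor j).comap_comp g f

/-- The deformation datum `(D s, X s ∩ X k)`, `s ∈ S`, on the scheme `X k`. -/
def onCenter (d : DeformationDatum X I) (S : Finset I) (k : I) :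
    DeformationDatum (d.center k).subscheme S :=
  (d.restrict S).pullback (d.center k).subschemeι

/-- The morphism `F(k, S)` from `𝔻((D s over X s ∩ X k) s, X k)` to `𝔻((D s over X s) s, X)`, where
`s` runs over `S`. -/
def F (d : DeformationDatum X I) (S : Finset I) (k : I) :
    (d.onCenter S k).space ⟶ (d.restrict S).space :=
  ((d.restrict S).mapsTo_pullback (d.center k).subschemeι).map

lemma F_toBase (d : DeformationDatum X I) (S : Finset I) (k : I) :
    d.F S k ≫ (d.restrict S).toBase = (d.onCenter S k).toBase ≫ (d.center k).subschemeι :=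
  ((d.restrict S).mapsTo_pullback (d.center k).subschemeι).map_dilatationMap

lemma ker_F_mono (d : DeformationDatum X I) (S : Finset I) {k l : I} (h : k ≤ l) :
    (d.F S k).ker ≤ (d.F S l).ker := by
  have e := Scheme.IdealSheafData.inclusion_subschemeι (d.monotone_center h)
  have : IsClosedImmersion (Scheme.IdealSheafData.inclusion (d.monotone_center h)) := by
    have : IsClosedImmersion (Scheme.IdealSheafData.inclusion (d.monotone_center h) ≫
      (d.center k).subschemeι) := by rw [e]; infer_instance
    exact IsClosedImmersion.of_comp _ (d.center k).subschemeι
  have h1 := Scheme.Multicenter.MapsTo.map_comp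
    ((d.restrict S).mapsTo_pullback (d.center k).subschemeι)
    ((d.restrict S).mapsTo_pullback_pullback _ _ _ e)
    ((d.restrict S).mapsTo_pullback (d.center l).subschemeι) e
  have h2 : (d.F S l).ker = (((d.restrict S).mapsTo_pullback_pullback _ _ _ e).map ≫ d.F S k).ker :=
    congrArg Scheme.Hom.ker h1.symm
  rw [h2]
  exact Scheme.Hom.le_ker_comp _ _

/-- The deformation datum on `𝔻((D s over X s) s, X)`, `s ∈ S`, that is indexed by the complement
`K` of `S`. Its center of index `k ∈ K` is the closed subscheme corresponding to the closed
immersion `F(k, S)`, and its divisor of index `k` is the preimage of `D k`. -/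
def iterated [Fintype I] (d : DeformationDatum X I) (S : Finset I) :
    DeformationDatum (d.restrict S).space (Sᶜ : Finset I) where
  center k := (d.F S k).ker
  divisor k := (d.divisor k).comap (d.restrict S).toBase
  monotone_center _ _ h := d.ker_F_mono S h
  isLocallyPrincipal k := (d.isLocallyPrincipal k).comap _

/-- The regularity conditions on the closed subschemes of `X` of a deformation datum, with respect
to a subset `S` of `I` with complement `K`. (In terms of ideals, sums of closed subschemes are
products, unions are intersections, and intersections are sums.) -/
structure IsRegular [Fintype I] (d : DeformationDatum X I) (S : Finset I) : Prop where
  /-- `(∑ θ s • X s) ∪ X k = (∑ s > s', θ s • X s) + (θ s' - 1) • X s' + X k`, where `s'` is the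
  least `s` in `S_{> k}` with `θ s > 0`. -/
  sum_union : ∀ k ∈ Sᶜ, ∀ (θ : I → ℕ) (s' : I), IsLeast {s | s ∈ S ∧ k < s ∧ 0 < θ s} s' →
    (∏ s ∈ S with k < s, d.center s ^ θ s) ⊓ d.center k =
      (∏ s ∈ S with s' < s, d.center s ^ θ s) * d.center s' ^ (θ s' - 1) * d.center k
  /-- `(⋂ e, (∑ γ e s • D s + ∑ θ e s • X s)) ∪ X k
  = ⋂ e, (∑ γ e s • D s + ((∑ θ e s • X s) ∪ X k))`, where the sums of multiples of the `D s` are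
  over all `s` in `S` and the sums of multiples of the `X s` are over `s` in `S_{> k}`. -/
  inter_union : ∀ k ∈ Sᶜ, (∃ s ∈ S, k < s) → ∀ (E : Type) (γ θ : E → I → ℕ),
    (⨆ e, (∏ s ∈ S, d.divisor s ^ γ e s) * ∏ s ∈ S with k < s, d.center s ^ θ e s) ⊓ d.center k =
      ⨆ e, (∏ s ∈ S, d.divisor s ^ γ e s) *
        ((∏ s ∈ S with k < s, d.center s ^ θ e s) ⊓ d.center k)

end DeformationDatum

end AlgebraicGeometry
end

/-!
The deformation spaces are treated through the universal property of dilatations. On a dilatation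
the divisors of the multi-center become Cartier divisors that are contained in the preimages of
the centers (`Scheme.Multicenter.isCartier_comap_divisor`,
`Scheme.Multicenter.exists_mul_eq_app`), and it is universal with this property: an affine
`X`-scheme on which the divisors are Cartier has at most one `X`-morphism to the dilatation
(`Scheme.Multicenter.hom_ext`), and it has one if the centers pull back into the divisors
(`Scheme.Multicenter.exists_lift`). All uniqueness statements follow, since pullback to a
dilatation preserves Cartier divisors. Over an affine open on which the divisors are principal,
the functions on a dilatation are generated by functions on the base and by the fractions `m / a`;
hence `F(k, S)` is a closed immersion.

`Θ(S)` exists because a fraction `m / ∏ a s`, the product being over the `s ≥ i` in `S`, lies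
in the kernel of `F(k, S)` for each `k ≥ i` outside `S` if `m` vanishes on `X i`. By the universal
property of the iterated space it can be divided by the remaining `a k`, with `k ≥ i`
(`DeformationRing.dvd_of_iterated`).

For the inverse of `Θ(S)` it has to be shown that every function `b` on `𝔻_S` that vanishes on the
center of index `k` becomes divisible by the product of the `a j`, `j ≥ k` outside `S`, on the
deformation space of `X` (`DeformationRing.dvd_of_mem_ker`). Fractions with numerators in the
ideal of `X s`, `s < k`, have this property, and `b` may be changed by them. What remains is a sum of
fractions with numerators in monomials in the ideals of the `X s`, `s > k`. With a common
denominator, the numerator of the sum vanishes on `X k`, because the divisors are Cartier on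
`X k`. By the second regularity condition it is then a sum of numerators of the same shape, each
of which vanishes on `X k`; by the first one a factor from the ideal of `X s'`, `s' > k`, can in
each of them be traded for a factor from the ideal of `X k`, which is divisible by more.
-/

/-! ### Cartier divisors -/

noncomputable section
namespace AlgebraicGeometry

lemma mem_nonZeroDivisors_of_dvd {R : Type*} [CommRing R] {a b : R} (h : a ∣ b)
    (hb : b ∈ nonZeroDivisors R) : a ∈ nonZeroDivisors R := by
  obtain ⟨c, rfl⟩ := h
  exact (mul_mem_nonZeroDivisors.mp hb).1

namespace Scheme

variable {X Y : Scheme.{u}}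

/-- The restriction of sections to a smaller open. -/
abbrev restr {U V : X.Opens} (h : U ≤ V) : Γ(X, V) →+* Γ(X, U) :=
  (X.presheaf.map (homOfLE h).op).hom

lemma restr_restr {U V W : X.Opens} (h : U ≤ V) (h' : V ≤ W) (a : Γ(X, W)) :
    restr h (restr h' a) = restr (h.trans h') a := by
  simp only [restr]
  rw [← CommRingCat.comp_apply, ← Functor.map_comp]
  rfl

lemma restr_self {U : X.Opens} (a : Γ(X, U)) : restr le_rfl a = a :=
  congrArg (fun φ : Γ(X, U) ⟶ Γ(X, U) => φ.hom a) (X.presheaf.map_id _)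

lemma mem_nonZeroDivisors_of_forall_exists {V : X.Opens} (a : Γ(X, V))
    (h : ∀ x ∈ V, ∃ (W : X.Opens) (hW : W ≤ V), x ∈ W ∧
      restr hW a ∈ nonZeroDivisors Γ(X, W)) : a ∈ nonZeroDivisors Γ(X, V) := by
  choose W hW hx ha using fun x : V => h x.1 x.2
  rw [mem_nonZeroDivisors_iff_right]
  intro b hb
  refine TopCat.Sheaf.eq_of_locally_eq' X.sheaf W V (fun x => homOfLE (hW x))
    (fun x hxV => TopologicalSpace.Opens.mem_iSup.mpr ⟨⟨x, hxV⟩, hx ⟨x, hxV⟩⟩) _ _ fun x => ?_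
  refine Eq.trans ?_ (map_zero (restr (hW x))).symm
  refine (mem_nonZeroDivisors_iff_right.mp (ha x)) _ ?_
  rw [← map_zero (restr (hW x)), ← hb, map_mul]
  rfl

lemma exists_affineOpens_mem_le {U : X.Opens} {x : X} (hx : x ∈ U) :
    ∃ W : X.affineOpens, x ∈ W.1 ∧ W.1 ≤ U := by
  obtain ⟨_, ⟨V, hV, rfl⟩, hxV, hVU⟩ := X.isBasis_affineOpens.exists_subset_of_mem_open hx U.2
  exact ⟨⟨V, hV⟩, hxV, hVU⟩

namespace IdealSheafData

lemma ideal_eq_span_restr (J : X.IdealSheafData) {U V : X.affineOpens} (h : U.1 ≤ V.1)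
    {a : Γ(X, V.1)} (ha : J.ideal V = Ideal.span {a}) :
    J.ideal U = Ideal.span {restr h a} := by
  rw [← J.map_ideal (U := U) (V := V) h, ha, Ideal.map_span, Set.image_singleton]
  rfl

/-- A local generator of the ideal of a Cartier divisor is a non-zero-divisor on every open
subset. -/
lemma IsCartier.restr_mem_nonZeroDivisors {J : X.IdealSheafData} (hJ : J.IsCartier)
    {V : X.affineOpens} {a : Γ(X, V.1)} (ha : J.ideal V = Ideal.span {a}) {W : X.Opens}
    (hW : W ≤ V.1) : restr hW a ∈ nonZeroDivisors Γ(X, W) := by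
  refine mem_nonZeroDivisors_of_forall_exists _ fun x hx => ?_
  obtain ⟨U, hxU, b, hb, hJb⟩ := hJ x
  obtain ⟨f, hfW, hxf⟩ := U.2.exists_basicOpen_le (V := W ⊓ U.1) ⟨x, hx, hxU⟩ hxU
  refine ⟨X.basicOpen f, hfW.trans inf_le_left, hxf, ?_⟩
  have h1 : X.basicOpen f ≤ U.1 := X.basicOpen_le f
  have h2 : restr h1 b ∈ nonZeroDivisors Γ(X, X.basicOpen f) := by
    have := U.2.isLocalization_basicOpen f
    exact IsLocalization.map_nonZeroDivisors_le (.powers f) Γ(X, X.basicOpen f)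
      (Submonoid.mem_map_of_mem _ hb)
  refine mem_nonZeroDivisors_of_dvd ?_ h2
  have h3 := (J.ideal_eq_span_restr (U := X.affineBasicOpen f)
    ((hfW.trans inf_le_left).trans hW) ha).symm.trans
      (J.ideal_eq_span_restr (U := X.affineBasicOpen f) h1 hJb)
  rw [restr_restr]
  exact Ideal.mem_span_singleton.mp (h3.ge (Ideal.mem_span_singleton_self _))

lemma IsCartier.mem_nonZeroDivisors {J : X.IdealSheafData} (hJ : J.IsCartier)
    {V : X.affineOpens} {a : Γ(X, V.1)} (ha : J.ideal V = Ideal.span {a}) :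
    a ∈ nonZeroDivisors Γ(X, V.1) := by
  have := hJ.restr_mem_nonZeroDivisors ha le_rfl
  rwa [restr_self] at this

lemma exists_affineOpens_le {U V : X.affineOpens} {x : X} (hU : x ∈ U.1) (hV : x ∈ V.1) :
    ∃ W : X.affineOpens, x ∈ W.1 ∧ W.1 ≤ U.1 ∧ W.1 ≤ V.1 := by
  obtain ⟨W, hxW, hW⟩ := exists_affineOpens_mem_le (U := U.1 ⊓ V.1) (x := x) ⟨hU, hV⟩
  exact ⟨W, hxW, hW.trans inf_le_left, hW.trans inf_le_right⟩

lemma IsCartier.of_le {J J' : X.IdealSheafData} (hJ : J.IsCartier) (h : J ≤ J')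
    (hJ' : J'.IsLocallyPrincipal) : J'.IsCartier := by
  intro x
  obtain ⟨U, hxU, a, ha⟩ := hJ' x
  obtain ⟨V, hxV, b, -, hb⟩ := hJ x
  obtain ⟨W, hxW, hWU, hWV⟩ := exists_affineOpens_le hxU hxV
  refine ⟨W, hxW, restr hWU a, mem_nonZeroDivisors_of_dvd ?_ (hJ.restr_mem_nonZeroDivisors hb hWV),
    J'.ideal_eq_span_restr hWU ha⟩
  rw [← Ideal.mem_span_singleton, ← J'.ideal_eq_span_restr hWU ha]
  refine h W ?_
  rw [J.ideal_eq_span_restr hWV hb]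
  exact Ideal.mem_span_singleton_self _

lemma isCartier_top : (⊤ : X.IdealSheafData).IsCartier := by
  intro x
  obtain ⟨U, hxU⟩ := TopologicalSpace.Opens.mem_iSup.mp
    ((iSup_affineOpens_eq_top X).ge (Set.mem_univ x))
  exact ⟨U, hxU, 1, one_mem _, by simp⟩

lemma IsCartier.mul {I J : X.IdealSheafData} (hI : I.IsCartier)
    (hJ : J.IsCartier) : (I * J).IsCartier := by
  intro x
  obtain ⟨U, hxU, a, -, ha⟩ := hI x
  obtain ⟨V, hxV, b, -, hb⟩ := hJ x
  obtain ⟨W, hxW, hWU, hWV⟩ := exists_affineOpens_le hxU hxV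
  refine ⟨W, hxW, restr hWU a * restr hWV b, mul_mem (hI.restr_mem_nonZeroDivisors ha hWU)
    (hJ.restr_mem_nonZeroDivisors hb hWV), ?_⟩
  rw [ideal_mul, Pi.mul_apply, I.ideal_eq_span_restr hWU ha, J.ideal_eq_span_restr hWV hb,
    Ideal.span_singleton_mul_span_singleton]

lemma IsCartier.prod {ι : Type*} (s : Finset ι) {J : ι → X.IdealSheafData}
    (hJ : ∀ i ∈ s, (J i).IsCartier) : (∏ i ∈ s, J i).IsCartier :=
  Finset.prod_induction _ _ (fun _ _ => .mul) isCartier_top hJ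

lemma ideal_prod {ι : Type*} (s : Finset ι) (J : ι → X.IdealSheafData) (U : X.affineOpens) :
    (∏ i ∈ s, J i).ideal U = ∏ i ∈ s, (J i).ideal U := by
  classical
  induction s using Finset.induction_on with
  | empty => simp
  | insert i s hi ih =>
    rw [Finset.prod_insert hi, Finset.prod_insert hi, ideal_mul, Pi.mul_apply, ih]

lemma ideal_prod_eq_span {ι : Type*} (s : Finset ι) {J : ι → X.IdealSheafData}
    {U : X.affineOpens} {a : ι → Γ(X, U.1)} (ha : ∀ i ∈ s, (J i).ideal U = Ideal.span {a i}) :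
    (∏ i ∈ s, J i).ideal U = Ideal.span {∏ i ∈ s, a i} := by
  rw [ideal_prod, Finset.prod_congr rfl ha, Ideal.prod_span_singleton]

lemma prod_le {ι : Type*} {s : Finset ι} (J : ι → X.IdealSheafData) {i : ι} (hi : i ∈ s) :
    ∏ i ∈ s, J i ≤ J i := by
  intro U
  rw [ideal_prod]
  exact Ideal.prod_le_inf.trans (Finset.inf_le hi)

lemma exists_affineOpens_le_preimage (f : X ⟶ Y) (U : Y.Opens) {x : X} (hx : f x ∈ U) :
    ∃ V : X.affineOpens, x ∈ V.1 ∧ V.1 ≤ f ⁻¹ᵁ U :=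
  exists_affineOpens_mem_le (U := f ⁻¹ᵁ U) hx

lemma ideal_comap_eq_span (J : Y.IdealSheafData) (f : X ⟶ Y) (U : Y.affineOpens)
    (V : X.affineOpens) (h : V.1 ≤ f ⁻¹ᵁ U.1) {a : Γ(Y, U.1)} (ha : J.ideal U = Ideal.span {a}) :
    (J.comap f).ideal V = Ideal.span {(f.appLE U.1 V.1 h).hom a} := by
  rw [J.ideal_comap f U V h, ha, Ideal.map_span, Set.image_singleton]

lemma comap_mul (J J' : Y.IdealSheafData) (f : X ⟶ Y) :
    (J * J').comap f = J.comap f * J'.comap f := by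
  have h (x : X) : ∃ (U : Y.affineOpens) (V : X.affineOpens), x ∈ V.1 ∧ V.1 ≤ f ⁻¹ᵁ U.1 := by
    obtain ⟨U, hxU⟩ := TopologicalSpace.Opens.mem_iSup.mp
      ((iSup_affineOpens_eq_top Y).ge (Set.mem_univ (f x)))
    obtain ⟨V, hV⟩ := exists_affineOpens_le_preimage f U.1 hxU
    exact ⟨U, V, hV⟩
  choose U V hV hVU using h
  refine ext_of_iSup_eq_top V ?_ fun x => ?_
  · exact top_le_iff.mp fun x _ => TopologicalSpace.Opens.mem_iSup.mpr ⟨x, hV x⟩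
  · rw [ideal_comap _ f (U x) (V x) (hVU x), ideal_mul, ideal_mul, Pi.mul_apply, Pi.mul_apply,
      ideal_comap _ f (U x) (V x) (hVU x), ideal_comap _ f (U x) (V x) (hVU x), Ideal.map_mul]

lemma comap_prod {ι : Type*} (s : Finset ι) (J : ι → Y.IdealSheafData) (f : X ⟶ Y) :
    (∏ i ∈ s, J i).comap f = ∏ i ∈ s, (J i).comap f := by
  classical
  induction s using Finset.induction_on with
  | empty => simp only [Finset.prod_empty, one_eq_top, comap_top]
  | insert a s ha ih => rw [Finset.prod_insert ha, Finset.prod_insert ha, comap_mul, ih]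

/-- Cartier divisors can be pulled back along open immersions. -/
lemma IsCartier.comap_of_isOpenImmersion {J : Y.IdealSheafData} (hJ : J.IsCartier) (f : X ⟶ Y)
    [IsOpenImmersion f] : (J.comap f).IsCartier := by
  intro x
  obtain ⟨U, hxU, a, -, ha⟩ := hJ (f x)
  obtain ⟨V, hxV, hVU⟩ := exists_affineOpens_le_preimage f U.1 hxU
  refine ⟨V, hxV, _, ?_, ideal_comap_eq_span J f U V hVU ha⟩
  have h1 : f ''ᵁ V.1 ≤ U.1 := by
    rintro _ ⟨y, hy, rfl⟩
    exact hVU hy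
  have h2 := hJ.restr_mem_nonZeroDivisors ha h1
  have h3 : f.appLE U.1 V.1 hVU = Y.presheaf.map (homOfLE h1).op ≫ (f.appIso V.1).hom := by
    rw [Hom.appIso_hom', Hom.map_appLE]
  rw [h3]
  let e := (f.appIso V.1).commRingCatIsoToRingEquiv
  refine mem_nonZeroDivisors_of_injective (f := e.symm) e.symm.injective ?_
  exact (congrArg (· ∈ nonZeroDivisors _) (e.symm_apply_apply (restr h1 a))).mpr h2

/-- Inclusions between pullbacks of ideals can be checked by divisibility, on affine opens of the
target. -/
lemma comap_le_comap_of_dvd {J J' : Y.IdealSheafData} (f : X ⟶ Y) [IsAffineHom f]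
    (h : ∀ y : Y, ∃ U : Y.affineOpens, y ∈ U.1 ∧ ∃ w : Γ(Y, U.1), J'.ideal U = Ideal.span {w} ∧
      ∀ m ∈ J.ideal U, (f.app U.1).hom w ∣ (f.app U.1).hom m) :
    J.comap f ≤ J'.comap f := by
  choose U hU w hw hdvd using h
  let V (y : Y) : X.affineOpens := ⟨f ⁻¹ᵁ (U y).1, (U y).2.preimage f⟩
  refine le_of_iSup_eq_top V (top_le_iff.mp fun x _ =>
    TopologicalSpace.Opens.mem_iSup.mpr ⟨f x, hU (f x)⟩) fun y => ?_
  rw [ideal_comap _ f (U y) (V y) le_rfl, ideal_comap_eq_span _ f (U y) (V y) le_rfl (hw y),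
    Ideal.map_le_iff_le_comap]
  intro m hm
  have := hdvd y m hm
  rw [Hom.app_eq_appLE] at this
  exact Ideal.mem_span_singleton.mpr this

/-- Finitely many locally principal ideals can be simultaneously trivialized. -/
lemma exists_affineOpens_forall_eq_span {ι : Type*} (s : Finset ι) {J : ι → X.IdealSheafData}
    (hJ : ∀ i ∈ s, (J i).IsLocallyPrincipal) (x : X) : ∃ U : X.affineOpens, x ∈ U.1 ∧
      ∀ i ∈ s, ∃ a : Γ(X, U.1), (J i).ideal U = Ideal.span {a} := by
  classical
  induction s using Finset.induction_on with
  | empty =>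
    obtain ⟨U, hxU⟩ := TopologicalSpace.Opens.mem_iSup.mp
      ((iSup_affineOpens_eq_top X).ge (Set.mem_univ x))
    exact ⟨U, hxU, by simp⟩
  | insert i s hi ih =>
    obtain ⟨U, hxU, hU⟩ := ih fun j hj => hJ j (Finset.mem_insert_of_mem hj)
    obtain ⟨V, hxV, b, hb⟩ := hJ i (Finset.mem_insert_self i s) x
    obtain ⟨W, hxW, hWU, hWV⟩ := exists_affineOpens_le hxU hxV
    refine ⟨W, hxW, fun j hj => ?_⟩
    obtain rfl | hj := Finset.mem_insert.mp hj
    · exact ⟨_, ideal_eq_span_restr _ hWV hb⟩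
    · obtain ⟨a, ha⟩ := hU j hj
      exact ⟨_, ideal_eq_span_restr _ hWU ha⟩

end IdealSheafData
end Scheme
/-! ### The functions on a dilatation over an affine open -/

open Scheme.AffineZariskiSite TopologicalSpace
namespace Scheme
namespace Multicenter

variable {X : Scheme.{u}} {ι : Type v} [Fintype ι] (c : X.Multicenter ι)

lemma exists_affine_forall_eq_span (x : X) : ∃ (U : X.AffineZariskiSite)
    (a : ι → Γ(X, U.1)), x ∈ U.1 ∧ ∀ i, (c.divisor i).ideal ⟨U.1, U.2⟩ = Ideal.span {a i} := by
  obtain ⟨U, hxU, h⟩ := IdealSheafData.exists_affineOpens_forall_eq_span Finset.univ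
    (fun i _ => c.isLocallyPrincipal i) x
  choose a ha using fun i => h i (Finset.mem_univ i)
  exact ⟨⟨U.1, U.2⟩, a, hxU, ha⟩

section Affine

variable {c} {U : X.AffineZariskiSite} {a : ι → Γ(X, U.1)}
  (ha : ∀ i, (c.divisor i).ideal ⟨U.1, U.2⟩ = Ideal.span {a i})

include ha

lemma inf_compl_eq_basicOpen : U.1 ⊓ c.compl = X.basicOpen (∏ i, a i) := by
  have h1 : (∏ i, c.divisor i).ideal ⟨U.1, U.2⟩ = Ideal.span {∏ i, a i} :=
    IdealSheafData.ideal_prod_eq_span _ fun i _ => ha i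
  ext x
  by_cases hx : x ∈ U.1
  · have h2 := IdealSheafData.mem_support_iff_of_mem (I := ∏ i, c.divisor i)
      (U := ⟨U.1, U.2⟩) hx
    rw [h1, Scheme.zeroLocus_span, Scheme.mem_zeroLocus_iff] at h2
    simp only [Set.mem_singleton_iff, forall_eq] at h2
    change (x ∈ U.1 ∧ x ∉ (∏ i, c.divisor i).support) ↔ x ∈ X.basicOpen (∏ i, a i)
    rw [h2]
    simp [hx]
  · exact ⟨fun h => absurd h.1 hx, fun h => absurd (X.basicOpen_le _ h) hx⟩

lemma isLocalization_res :
    letI := (c.res U.1).toAlgebra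
    IsLocalization.Away (∏ i, a i) Γ(X, U.1 ⊓ c.compl) :=
  isLocalization_away_of_eq U.2.isCompact U.2.isQuasiSeparated _ (inf_compl_eq_basicOpen ha) _

lemma isUnit_res_prod : IsUnit (c.res U.1 (∏ i, a i)) := by
  let := (c.res U.1).toAlgebra
  have := isLocalization_res ha
  exact IsLocalization.Away.algebraMap_isUnit (S := Γ(X, U.1 ⊓ c.compl)) (∏ i, a i)

lemma isUnit_res (i : ι) : IsUnit (c.res U.1 (a i)) :=
  isUnit_of_dvd_unit (map_dvd _ (Finset.dvd_prod_of_mem a (Finset.mem_univ i)))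
    (isUnit_res_prod ha)

lemma exists_prod_pow_mul_eq_res (b : Γ(X, U.1 ⊓ c.compl)) :
    ∃ (n : ℕ) (x : Γ(X, U.1)), c.res U.1 (∏ i, a i) ^ n * b = c.res U.1 x := by
  let := (c.res U.1).toAlgebra
  have := isLocalization_res ha
  obtain ⟨⟨x, ⟨_, n, rfl⟩⟩, h⟩ := IsLocalization.surj (.powers (∏ i, a i)) b
  refine ⟨n, x, ?_⟩
  rw [mul_comm, ← map_pow]
  exact h

lemma exists_prod_pow_mul_eq_zero {x : Γ(X, U.1)} (hx : c.res U.1 x = 0) :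
    ∃ n : ℕ, (∏ i, a i) ^ n * x = 0 := by
  let := (c.res U.1).toAlgebra
  have := isLocalization_res ha
  obtain ⟨⟨_, n, rfl⟩, h⟩ := IsLocalization.exists_of_eq (M := .powers (∏ i, a i))
    (S := Γ(X, U.1 ⊓ c.compl)) (hx.trans (map_zero _).symm)
  exact ⟨n, h.trans (mul_zero _)⟩

lemma mem_fractions_iff {i : ι} {b : Γ(X, U.1 ⊓ c.compl)} :
    b ∈ c.fractions U i ↔
      ∃ m ∈ (c.center i).ideal ⟨U.1, U.2⟩, c.res U.1 (a i) * b = c.res U.1 m := by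
  refine ⟨fun h => h _ ((ha i).ge (Ideal.mem_span_singleton_self _)), ?_⟩
  rintro ⟨m, hm, e⟩ x hx
  obtain ⟨y, rfl⟩ := Ideal.mem_span_singleton'.mp ((ha i).le hx)
  exact ⟨y * m, Ideal.mul_mem_left _ _ hm, by rw [map_mul, mul_assoc, e, map_mul]⟩

lemma exists_mul_eq_toRing {i : ι} {m : Γ(X, U.1)} (hm : m ∈ (c.center i).ideal ⟨U.1, U.2⟩) :
    ∃ b : c.ring U, c.toRing U (a i) * b = c.toRing U m := by
  obtain ⟨b, hb⟩ := (isUnit_res ha i).exists_right_inv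
  have h : c.res U.1 (a i) * (b * c.res U.1 m) = c.res U.1 m := by rw [← mul_assoc, hb, one_mul]
  exact ⟨⟨_, c.mem_ring_of_mem_fractions ((mem_fractions_iff ha).mpr ⟨m, hm, h⟩)⟩,
    Subtype.ext h⟩

lemma toRing_mem_nonZeroDivisors (i : ι) : c.toRing U (a i) ∈ nonZeroDivisors (c.ring U) :=
  mem_nonZeroDivisors_of_injective (f := (c.ring U).subtype) Subtype.val_injective
    (isUnit_res ha i).mem_nonZeroDivisors

lemma closure_toRing : Subring.closure (Set.range (c.toRing U) ∪
    ⋃ i, {b | ∃ m ∈ (c.center i).ideal ⟨U.1, U.2⟩, c.toRing U (a i) * b = c.toRing U m}) = ⊤ := by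
  rw [eq_top_iff]
  rintro ⟨b, hb⟩ -
  refine Subring.closure_induction (p := fun b hb => (⟨b, hb⟩ : c.ring U) ∈ Subring.closure _)
    ?_ ?_ ?_ ?_ ?_ ?_ hb
  · rintro _ (⟨x, rfl⟩ | h)
    · exact Subring.subset_closure (.inl ⟨x, rfl⟩)
    · obtain ⟨i, hi⟩ := Set.mem_iUnion.mp h
      obtain ⟨m, hm, e⟩ := (mem_fractions_iff ha).mp hi
      exact Subring.subset_closure (.inr (Set.mem_iUnion_of_mem i ⟨m, hm, Subtype.ext e⟩))
  · exact zero_mem _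
  · exact one_mem _
  · exact fun _ _ _ _ hx hy => add_mem hx hy
  · exact fun _ _ hx => neg_mem hx
  · exact fun _ _ _ _ hx hy => mul_mem hx hy

end Affine

lemma toΓ_toRing (U : X.AffineZariskiSite) (x : Γ(X, U.1)) :
    c.toΓ U (c.toRing U x) = (c.dilatationMap.app U.1).hom x := by
  have h1 : Spec.map (CommRingCat.ofHom (c.toRing U) ≫ CommRingCat.ofHom (c.toΓ U)) =
      Spec.map (c.dilatationMap.app U.1) := by
    have h5 : IsIso (c.dilatationMap ⁻¹ᵁ U.1).toSpecΓ :=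
      inferInstanceAs (IsIso (c.isAffineOpen_preimage_dilatationMap U).isoSpec.hom)
    rw [← cancel_epi (c.dilatationMap ⁻¹ᵁ U.1).toSpecΓ, ← cancel_mono (IsAffineOpen.fromSpec U.2),
      Spec.map_comp]
    have h3 := IsAffineOpen.SpecMap_appLE_fromSpec c.dilatationMap U.2
      (c.isAffineOpen_preimage_dilatationMap U) le_rfl
    rw [← Hom.app_eq_appLE] at h3
    have h4 := c.toSpecΓ_toΓ U
    have h6 := c.chart_dilatationMap U
    have h7 := c.preimageIso_hom_chart U
    calc _ = ((c.dilatationMap ⁻¹ᵁ U.1).toSpecΓ ≫ Spec.map (CommRingCat.ofHom (c.toΓ U))) ≫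
          Spec.map (CommRingCat.ofHom (c.toRing U)) ≫ IsAffineOpen.fromSpec U.2 := by
            simp only [Category.assoc]
      _ = (c.dilatationMap ⁻¹ᵁ U.1).ι ≫ c.dilatationMap := by
            rw [h4]
            refine (congrArg (_ ≫ ·) h6.symm).trans ?_
            rw [← Category.assoc, h7]
      _ = (c.dilatationMap ⁻¹ᵁ U.1).toSpecΓ ≫
            (c.isAffineOpen_preimage_dilatationMap U).fromSpec ≫ c.dilatationMap := by
            rw [← Category.assoc]
            congr 1
            exact (IsAffineOpen.isoSpec_hom_fromSpec _).symm
      _ = _ := by rw [← h3, ← Category.assoc]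
  exact congrArg (fun φ : Γ(X, U.1) ⟶ Γ(c.dilatation, c.dilatationMap ⁻¹ᵁ U.1) => φ.hom x)
    (Spec.map_injective h1)

lemma toΓ_bijective (U : X.AffineZariskiSite) : Function.Bijective (c.toΓ U) := by
  have h : Spec.map (CommRingCat.ofHom (c.toΓ U)) =
      (c.isAffineOpen_preimage_dilatationMap U).isoSpec.inv ≫ (c.preimageIso U).hom :=
    Spec.map_preimage _
  have h2 : IsIso (Spec.map (CommRingCat.ofHom (c.toΓ U))) := h ▸ inferInstance
  exact isIso_SpecMap_iff.mp h2

instance : IsAffineHom c.dilatationMap := by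
  choose U a hxU ha using c.exists_affine_forall_eq_span
  refine isAffineHom_of_forall_exists_isAffineOpen _ fun x =>
    ⟨(U x).1, hxU x, (U x).2, c.isAffineOpen_preimage_dilatationMap (U x)⟩

/-- The preimage of an affine open under the dilatation map. -/
abbrev preim (U : X.AffineZariskiSite) : c.dilatation.AffineZariskiSite :=
  preimageSite c.dilatationMap U

lemma app_mem_nonZeroDivisors_iff_toRing (U : X.AffineZariskiSite) (x : Γ(X, U.1)) :
    (c.dilatationMap.app U.1).hom x ∈ nonZeroDivisors Γ(c.dilatation, c.dilatationMap ⁻¹ᵁ U.1) ↔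
      c.toRing U x ∈ nonZeroDivisors (c.ring U) := by
  let e := RingEquiv.ofBijective _ (c.toΓ_bijective U)
  rw [← c.toΓ_toRing]
  constructor
  · exact mem_nonZeroDivisors_of_injective e.injective
  · intro h
    refine mem_nonZeroDivisors_of_injective (f := e.symm) e.symm.injective ?_
    exact (congrArg (· ∈ nonZeroDivisors _) (e.symm_apply_apply (c.toRing U x))).mpr h

lemma ideal_comap_dilatationMap {J : X.IdealSheafData} {U : X.AffineZariskiSite}
    {a : Γ(X, U.1)} (ha : J.ideal ⟨U.1, U.2⟩ = Ideal.span {a}) :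
    (J.comap c.dilatationMap).ideal ⟨(c.preim U).1, (c.preim U).2⟩ =
      Ideal.span {(c.dilatationMap.app U.1).hom a} := by
  rw [IdealSheafData.ideal_comap_eq_span J c.dilatationMap ⟨U.1, U.2⟩ _ le_rfl ha,
    Hom.app_eq_appLE]
  rfl

/-- The divisors of a multi-center become Cartier divisors on the dilatation. -/
lemma isCartier_comap_divisor (i : ι) : ((c.divisor i).comap c.dilatationMap).IsCartier := by
  intro x
  obtain ⟨U, a, hxU, ha⟩ := c.exists_affine_forall_eq_span (c.dilatationMap x)
  exact ⟨⟨_, (c.preim U).2⟩, hxU, _, (c.app_mem_nonZeroDivisors_iff_toRing U _).mpr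
    (toRing_mem_nonZeroDivisors ha i), c.ideal_comap_dilatationMap (ha i)⟩

/-- Cartier divisors can be pulled back to dilatations, because the dilatation rings are subrings
of localizations. -/
lemma isCartier_comap {J : X.IdealSheafData} (hJ : J.IsCartier) :
    (J.comap c.dilatationMap).IsCartier := by
  intro x
  obtain ⟨U, hxU, a, -, ha⟩ := hJ (c.dilatationMap x)
  refine ⟨⟨_, (c.preim ⟨U.1, U.2⟩).2⟩, hxU, _,
    (c.app_mem_nonZeroDivisors_iff_toRing ⟨U.1, U.2⟩ _).mpr ?_,
    c.ideal_comap_dilatationMap (U := ⟨U.1, U.2⟩) ha⟩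
  exact mem_nonZeroDivisors_of_injective (f := (c.ring ⟨U.1, U.2⟩).subtype) Subtype.val_injective
    (hJ.restr_mem_nonZeroDivisors ha _)

section Affine

variable {c} {U : X.AffineZariskiSite} {a : ι → Γ(X, U.1)}
  (ha : ∀ i, (c.divisor i).ideal ⟨U.1, U.2⟩ = Ideal.span {a i})

include ha

/-- The functions on the dilatation are generated by functions on the base and by fractions. -/
lemma closure_app : Subring.closure (Set.range (c.dilatationMap.app U.1).hom ∪
    ⋃ i, {b | ∃ m ∈ (c.center i).ideal ⟨U.1, U.2⟩,
      (c.dilatationMap.app U.1).hom (a i) * b = (c.dilatationMap.app U.1).hom m}) = ⊤ := by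
  have h := congrArg (Subring.map (c.toΓ U)) (closure_toRing ha)
  rw [RingHom.map_closure, ← RingHom.range_eq_map,
    RingHom.range_eq_top_of_surjective _ (c.toΓ_bijective U).2] at h
  rw [eq_top_iff, ← h]
  refine Subring.closure_mono ?_
  rintro _ ⟨b, (⟨x, rfl⟩ | hb), rfl⟩
  · exact .inl ⟨x, (c.toΓ_toRing U x).symm⟩
  · obtain ⟨i, m, hm, e⟩ := Set.mem_iUnion.mp hb
    refine .inr (Set.mem_iUnion_of_mem i ⟨m, hm, ?_⟩)
    rw [← c.toΓ_toRing, ← c.toΓ_toRing, ← e, map_mul]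

/-- If the divisors are already Cartier on `X`, then the base ring embeds into the dilatation
ring. -/
lemma app_injective_of_isCartier (hc : ∀ i, (c.divisor i).IsCartier) :
    Function.Injective (c.dilatationMap.app U.1).hom := by
  rw [injective_iff_map_eq_zero]
  intro x hx
  rw [← c.toΓ_toRing, map_eq_zero_iff _ (c.toΓ_bijective U).1] at hx
  obtain ⟨n, hn⟩ := exists_prod_pow_mul_eq_zero ha (congrArg Subtype.val hx)
  refine (mul_left_mem_nonZeroDivisors_eq_zero_iff (pow_mem (prod_mem fun i _ => ?_) n)).mp hn
  exact (hc i).mem_nonZeroDivisors (ha i)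

lemma exists_mul_eq_app {i : ι} {m : Γ(X, U.1)} (hm : m ∈ (c.center i).ideal ⟨U.1, U.2⟩) :
    ∃ b, (c.dilatationMap.app U.1).hom (a i) * b = (c.dilatationMap.app U.1).hom m := by
  obtain ⟨b, hb⟩ := exists_mul_eq_toRing ha hm
  exact ⟨c.toΓ U b, by rw [← c.toΓ_toRing, ← c.toΓ_toRing, ← map_mul, hb]⟩

end Affine

end Multicenter
end Scheme
/-! ### The universal property of dilatations -/

namespace Scheme
namespace Multicenter

variable {X : Scheme.{u}} {ι : Type v} [Fintype ι] (c : X.Multicenter ι)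

/-- An `X`-scheme is covered by the preimages of affine opens of `X` on which all divisors are
principal. -/
lemma exists_openCover {T : Scheme.{u}} (f : T ⟶ X) : ∃ (U : X → X.AffineZariskiSite)
    (a : ∀ x, ι → Γ(X, (U x).1)),
    (∀ x i, (c.divisor i).ideal ⟨(U x).1, (U x).2⟩ = Ideal.span {a x i}) ∧
    IsOpenCover fun x => f ⁻¹ᵁ (U x).1 := by
  choose U a hxU ha using c.exists_affine_forall_eq_span
  exact ⟨U, a, ha, eq_top_iff.mpr fun x _ => Opens.mem_iSup.mpr ⟨f x, hxU (f x)⟩⟩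

variable {c}

lemma app_mem_nonZeroDivisors {T : Scheme.{u}} {f : T ⟶ X} {J : X.IdealSheafData}
    (hJ : (J.comap f).IsCartier) {U : X.affineOpens} {a : Γ(X, U.1)}
    (ha : J.ideal U = Ideal.span {a}) :
    (f.app U.1).hom a ∈ nonZeroDivisors Γ(T, f ⁻¹ᵁ U.1) := by
  refine mem_nonZeroDivisors_of_forall_exists _ fun x hx => ?_
  obtain ⟨V, hxV, hVU⟩ := exists_affineOpens_mem_le (U := f ⁻¹ᵁ U.1) hx
  exact ⟨V.1, hVU, hxV, hJ.mem_nonZeroDivisors (J.ideal_comap_eq_span f U V hVU ha)⟩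

lemma exists_toSpecΓ_comp_eq {T : Scheme.{u}} {V : T.Opens} {R : CommRingCat.{u}}
    (p : V.toScheme ⟶ Spec R) : ∃ φ : R ⟶ Γ(T, V), V.toSpecΓ ≫ Spec.map φ = p := by
  refine ⟨(ΓSpecIso R).inv ≫ p.appTop ≫ V.topIso.hom, ?_⟩
  have h1 : Spec.map V.topIso.inv ≫ Spec.map V.topIso.hom = 𝟙 _ := by
    rw [← Spec.map_comp, Iso.hom_inv_id, Spec.map_id]
  calc _ = V.toScheme.toSpecΓ ≫ (Spec.map V.topIso.inv ≫ Spec.map V.topIso.hom) ≫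
        Spec.map p.appTop ≫ Spec.map (ΓSpecIso R).inv := by
        rw [Spec.map_comp, Spec.map_comp, Opens.toSpecΓ]
        simp only [Category.assoc]
    _ = p ≫ (Spec R).toSpecΓ ≫ Spec.map (ΓSpecIso R).inv := by
        rw [h1, Category.id_comp, ← Category.assoc, ← Scheme.toSpecΓ_naturality, Category.assoc]
    _ = p := by rw [toSpecΓ_SpecMap_ΓSpecIso_inv, Category.comp_id]

lemma toSpecΓ_comp_injective {T : Scheme.{u}} {V : T.Opens} {R : CommRingCat.{u}}
    {φ ψ : R ⟶ Γ(T, V)} (h : V.toSpecΓ ≫ Spec.map φ = V.toSpecΓ ≫ Spec.map ψ) : φ = ψ := by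
  have key (φ : R ⟶ Γ(T, V)) : (ΓSpecIso R).inv ≫ (V.toSpecΓ ≫ Spec.map φ).appTop ≫
      V.topIso.hom = φ := by
    rw [Scheme.Hom.comp_appTop, Opens.toSpecΓ_appTop, Category.assoc, Category.assoc,
      ← ΓSpecIso_inv_naturality_assoc, Iso.inv_hom_id_assoc]
    exact (congrArg (φ ≫ ·) V.topIso.inv_hom_id).trans (Category.comp_id _)
  rw [← key φ, h, key ψ]

lemma toSpecΓ_comp_app {T : Scheme.{u}} (f : T ⟶ X) {U : X.Opens} (hU : IsAffineOpen U) :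
    (f ⁻¹ᵁ U).toSpecΓ ≫ Spec.map (f.app U) ≫ hU.fromSpec = (f ⁻¹ᵁ U).ι ≫ f := by
  rw [← Category.assoc, Opens.toSpecΓ_naturality, Category.assoc, IsAffineOpen.toSpecΓ_fromSpec,
    morphismRestrict_ι]

section Affine

variable {U : X.AffineZariskiSite} {a : ι → Γ(X, U.1)}
  (ha : ∀ i, (c.divisor i).ideal ⟨U.1, U.2⟩ = Ideal.span {a i})

include ha

/-- A homomorphism from a dilatation ring is determined by its restriction to the base ring, since
each fraction is a quotient in the base ring, with denominator a power of `∏ a i`. -/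
lemma ringHom_ext {C : Type*} [CommRing C] {φ ψ : c.ring U →+* C}
    (h : φ.comp (c.toRing U) = ψ.comp (c.toRing U))
    (hφ : ∀ i, φ (c.toRing U (a i)) ∈ nonZeroDivisors C) : φ = ψ := by
  ext b
  obtain ⟨n, x, hx⟩ := exists_prod_pow_mul_eq_res ha b.1
  have hx' : c.toRing U (∏ i, a i) ^ n * b = c.toRing U x := Subtype.ext hx
  have h1 (y) : φ (c.toRing U y) = ψ (c.toRing U y) := congrArg (· y) h
  have h2 := (congrArg φ hx').trans ((h1 x).trans (congrArg ψ hx').symm)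
  simp only [map_mul, map_pow, ← h1] at h2
  refine (mul_cancel_left_mem_nonZeroDivisors (pow_mem ?_ n)).mp h2
  simp only [map_prod]
  exact prod_mem fun i _ => hφ i

/-- The universal property of a dilatation ring. -/
lemma exists_ringHom {C : Type*} [CommRing C] (f : Γ(X, U.1) →+* C)
    (hf : ∀ i, f (a i) ∈ nonZeroDivisors C)
    (hc : ∀ i, ∀ m ∈ (c.center i).ideal ⟨U.1, U.2⟩, f (a i) ∣ f m) :
    ∃ φ : c.ring U →+* C, φ.comp (c.toRing U) = f := by
  let := (c.res U.1).toAlgebra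
  have := isLocalization_res ha
  let L := Localization.Away (f (∏ i, a i))
  have hinj : Function.Injective (algebraMap C L) := by
    refine IsLocalization.injective L (M := .powers (f (∏ i, a i))) ?_
    rw [Submonoid.powers_le, map_prod]
    exact prod_mem fun i _ => hf i
  let ψ : Γ(X, U.1 ⊓ c.compl) →+* L := IsLocalization.Away.lift (∏ i, a i)
    (g := (algebraMap C L).comp f) (IsLocalization.Away.algebraMap_isUnit (f (∏ i, a i)))
  have hψ (x) : ψ (c.res U.1 x) = algebraMap C L (f x) :=
    IsLocalization.Away.lift_eq (S := Γ(X, U.1 ⊓ c.compl)) (∏ i, a i) _ x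
  have hu (i) : IsUnit (algebraMap C L (f (a i))) := by
    rw [← hψ]
    exact (isUnit_res ha i).map ψ
  -- the map between the localizations sends the dilatation ring into `C`
  have hle : c.ring U ≤ (algebraMap C L).range.comap ψ := by
    refine Subring.closure_le.mpr ?_
    rintro _ (⟨x, rfl⟩ | hb)
    · exact ⟨f x, (hψ x).symm⟩
    · obtain ⟨i, hi⟩ := Set.mem_iUnion.mp hb
      obtain ⟨m, hm, e⟩ := (mem_fractions_iff ha).mp hi
      obtain ⟨y, hy⟩ := hc i m hm
      refine ⟨y, (hu i).mul_left_cancel ?_⟩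
      rw [← map_mul, ← hy, ← hψ, ← hψ, ← map_mul, e]
  let e : C ≃+* (algebraMap C L).range := RingEquiv.ofBijective (algebraMap C L).rangeRestrict
    ⟨fun x y h => hinj (congrArg Subtype.val h), (algebraMap C L).rangeRestrict_surjective⟩
  refine ⟨(e.symm : _ →+* C).comp (ψ.restrict (c.ring U) (algebraMap C L).range fun _ hb => hle hb), ?_⟩
  ext x
  refine e.symm_apply_eq.mpr (Subtype.ext ?_)
  exact hψ x

end Affine

/-- Morphisms to a dilatation are determined by their composition with the dilatation map, if
the divisors pull back to Cartier divisors. -/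
lemma hom_ext {T : Scheme.{u}} {p q : T ⟶ c.dilatation}
    (h : p ≫ c.dilatationMap = q ≫ c.dilatationMap)
    (hT : ∀ i, ((c.divisor i).comap (p ≫ c.dilatationMap)).IsCartier) : p = q := by
  obtain ⟨U, a, ha, hU⟩ := c.exists_openCover (p ≫ c.dilatationMap)
  refine Scheme.Cover.hom_ext (T.openCoverOfIsOpenCover _ hU) _ _ fun (x : X) => ?_
  let V : T.Opens := (p ≫ c.dilatationMap) ⁻¹ᵁ (U x).1
  change V.ι ≫ p = V.ι ≫ q
  have key (r : T ⟶ c.dilatation) (hr : r ≫ c.dilatationMap = p ≫ c.dilatationMap) :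
      ∃ r' : V.toScheme ⟶ Spec (.of (c.ring (U x))), r' ≫ c.chart (U x) = V.ι ≫ r := by
    refine ⟨IsOpenImmersion.lift (c.chart (U x)) (V.ι ≫ r) ?_, IsOpenImmersion.lift_fac _ _ _⟩
    rintro _ ⟨y, rfl⟩
    have h1 : (r ≫ c.dilatationMap) (V.ι y) ∈ (U x).1 := by
      rw [hr]
      exact y.2
    have h2 : r (V.ι y) ∈ c.dilatationMap ⁻¹ᵁ (U x).1 := h1
    rw [c.preimage_dilatationMap] at h2
    exact h2
  obtain ⟨p', hp⟩ := key p rfl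
  obtain ⟨q', hq⟩ := key q h.symm
  have h1 : p' ≫ Spec.map (CommRingCat.ofHom (c.toRing (U x))) =
      q' ≫ Spec.map (CommRingCat.ofHom (c.toRing (U x))) := by
    rw [← cancel_mono (IsAffineOpen.fromSpec (U x).2), Category.assoc, Category.assoc]
    refine (congrArg (p' ≫ ·) (c.chart_dilatationMap (U x)).symm).trans
      (Eq.trans ?_ (congrArg (q' ≫ ·) (c.chart_dilatationMap (U x))))
    rw [← Category.assoc, ← Category.assoc, hp, hq, Category.assoc, Category.assoc, h]
  -- morphisms to `Spec (c.ring (U x))` correspond to ring homomorphisms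
  obtain ⟨φ, rfl⟩ := exists_toSpecΓ_comp_eq p'
  obtain ⟨ψ, rfl⟩ := exists_toSpecΓ_comp_eq q'
  have h2 : CommRingCat.ofHom (c.toRing (U x)) ≫ φ = (p ≫ c.dilatationMap).app (U x).1 := by
    refine toSpecΓ_comp_injective ((cancel_mono (IsAffineOpen.fromSpec (U x).2)).mp ?_)
    rw [Category.assoc, Category.assoc, toSpecΓ_comp_app]
    refine (?_ : _ = V.toSpecΓ ≫ Spec.map φ ≫ _).trans ((congrArg (V.toSpecΓ ≫ Spec.map φ ≫ ·)
      (c.chart_dilatationMap (U x)).symm).trans ?_)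
    · rw [Spec.map_comp, Category.assoc]
    · rw [← Category.assoc V.ι, ← hp, Category.assoc, Category.assoc]
  have h3 : CommRingCat.ofHom (c.toRing (U x)) ≫ φ = CommRingCat.ofHom (c.toRing (U x)) ≫ ψ := by
    refine toSpecΓ_comp_injective ?_
    rw [Spec.map_comp, Spec.map_comp, ← Category.assoc, ← Category.assoc, h1]
  have h4 : φ.hom = ψ.hom := by
    refine ringHom_ext (ha x) (congrArg CommRingCat.Hom.hom h3) fun i => ?_
    have h5 := congrArg (fun χ : Γ(X, (U x).1) ⟶ Γ(T, V) => χ.hom (a x i)) h2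
    refine (congrArg (· ∈ nonZeroDivisors _) h5).mpr ?_
    exact app_mem_nonZeroDivisors (hT i) (ha x i)
  rw [← hp, ← hq, CommRingCat.hom_ext h4]

/-- The universal property of dilatations: a morphism `f : T ⟶ X` lifts to the dilatation if the
divisors pull back to Cartier divisors on `T` that are contained in the pullbacks of the
centers. -/
lemma exists_lift {T : Scheme.{u}} (f : T ⟶ X) [IsAffineHom f]
    (hT : ∀ i, ((c.divisor i).comap f).IsCartier)
    (hc : ∀ i, (c.center i).comap f ≤ (c.divisor i).comap f) :
    ∃ g : T ⟶ c.dilatation, g ≫ c.dilatationMap = f := by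
  obtain ⟨U, a, ha, hU⟩ := c.exists_openCover f
  have key (x : X) : ∃ g : (f ⁻¹ᵁ (U x).1).toScheme ⟶ c.dilatation,
      g ≫ c.dilatationMap = (f ⁻¹ᵁ (U x).1).ι ≫ f := by
    have hdvd (i) (m : Γ(X, (U x).1)) (hm : m ∈ (c.center i).ideal ⟨(U x).1, (U x).2⟩) :
        (f.app (U x).1).hom (a x i) ∣ (f.app (U x).1).hom m := by
      have h1 := (c.center i).map_le_ideal_comap f ⟨(U x).1, (U x).2⟩
        ⟨_, (U x).2.preimage f⟩ le_rfl (Ideal.mem_map_of_mem _ hm)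
      have h2 := hc i _ h1
      rw [IdealSheafData.ideal_comap_eq_span _ f ⟨(U x).1, (U x).2⟩
        ⟨_, (U x).2.preimage f⟩ le_rfl (ha x i), Ideal.mem_span_singleton] at h2
      rw [Hom.app_eq_appLE]
      exact h2
    obtain ⟨φ, hφ⟩ := exists_ringHom (ha x) (f.app (U x).1).hom
      (fun i => app_mem_nonZeroDivisors (hT i) (ha x i)) hdvd
    refine ⟨(f ⁻¹ᵁ (U x).1).toSpecΓ ≫ Spec.map (CommRingCat.ofHom φ) ≫ c.chart (U x), ?_⟩
    rw [Category.assoc, Category.assoc, ← toSpecΓ_comp_app f (U x).2]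
    refine (congrArg ((f ⁻¹ᵁ (U x).1).toSpecΓ ≫ Spec.map (CommRingCat.ofHom φ) ≫ ·)
      (c.chart_dilatationMap (U x))).trans ?_
    rw [← Spec.map_comp_assoc]
    congr 3
    exact CommRingCat.hom_ext hφ
  let 𝒰 := T.openCoverOfIsOpenCover _ hU
  have key' (x : 𝒰.I₀) : ∃ g : 𝒰.X x ⟶ c.dilatation, g ≫ c.dilatationMap = 𝒰.f x ≫ f := key x
  choose g hg using key'
  -- the local lifts agree on overlaps because lifts are unique
  have hglue (x y : 𝒰.I₀) : pullback.fst (𝒰.f x) (𝒰.f y) ≫ g x =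
      pullback.snd (𝒰.f x) (𝒰.f y) ≫ g y := by
    have e : (pullback.fst (𝒰.f x) (𝒰.f y) ≫ g x) ≫ c.dilatationMap =
        (pullback.fst (𝒰.f x) (𝒰.f y) ≫ 𝒰.f x) ≫ f := by
      rw [Category.assoc, hg, Category.assoc]
    refine hom_ext ?_ fun i => ?_
    · rw [e, pullback.condition, Category.assoc, Category.assoc, hg]
    · rw [e, IdealSheafData.comap_comp]
      exact (hT i).comap_of_isOpenImmersion _
  refine ⟨𝒰.glueMorphisms g hglue, Scheme.Cover.hom_ext 𝒰 _ _ fun x => ?_⟩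
  rw [← Category.assoc, Scheme.Cover.ι_glueMorphisms]
  exact hg x

end Multicenter
end Scheme
/-! ### Commutative algebra of deformation rings -/

namespace DeformationRing

variable {I : Type*} [LinearOrder I]

/-- The product of the `a j` over the `j ≥ i` in `T`. -/
def prodGE {A : Type*} [CommMonoid A] (T : Finset I) (a : I → A) (i : I) : A :=
  ∏ j ∈ T with i ≤ j, a j

section CommMonoid

variable {A : Type*} [CommMonoid A] (T : Finset I) (a : I → A)

lemma prodGE_dvd {i i' : I} (h : i ≤ i') : prodGE T a i' ∣ prodGE T a i :=
  Finset.prod_dvd_prod_of_subset _ _ _ (Finset.monotone_filter_right _ fun _ _ hj => h.trans hj)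

lemma prodGE_mul_prodGE_compl [Fintype I] (i : I) :
    prodGE T a i * prodGE Tᶜ a i = ∏ j with i ≤ j, a j := by
  simp only [prodGE, Finset.prod_filter]
  exact Finset.prod_mul_prod_compl T _

lemma prod_subtype_with_le (t : T) :
    ∏ j : T with t ≤ j, a j = prodGE T a t := by
  rw [prodGE, Finset.prod_filter, Finset.prod_filter, ← Finset.prod_coe_sort T]
  rfl

lemma prod_prodGE_pow (k : I) (θ : I → ℕ) :
    ∏ s ∈ T with k < s, prodGE T a s ^ θ s =
      ∏ t ∈ T, a t ^ (∑ s ∈ T with k < s, if s ≤ t then θ s else 0) := by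
  simp_rw [prodGE, Finset.prod_filter _ a, ← Finset.prod_pow, ← Finset.prod_pow_eq_pow_sum]
  rw [Finset.prod_comm]
  refine Finset.prod_congr rfl fun t _ => Finset.prod_congr rfl fun s _ => ?_
  split_ifs <;> simp

/-- If there is an element `≥ i` in `T`, then the least such element has the same product. -/
lemma prodGE_eq_one_or_exists (i : I) :
    prodGE T a i = 1 ∨ ∃ t ∈ T, i ≤ t ∧ prodGE T a i = prodGE T a t := by
  obtain h | h := (T.filter (i ≤ ·)).eq_empty_or_nonempty
  · exact .inl (by rw [prodGE, h, Finset.prod_empty])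
  · have h1 := Finset.mem_filter.mp ((T.filter (i ≤ ·)).min'_mem h)
    refine .inr ⟨_, h1.1, h1.2, ?_⟩
    rw [prodGE, prodGE]
    refine Finset.prod_congr (Finset.filter_congr fun j hj => ⟨fun hij => ?_, h1.2.trans⟩)
      fun _ _ => rfl
    exact Finset.min'_le _ _ (Finset.mem_filter.mpr ⟨hj, hij⟩)

end CommMonoid

lemma prodGE_mem {A σ : Type*} [CommMonoid A] [SetLike σ A] [SubmonoidClass σ A] {N : σ}
    {T : Finset I} {a : I → A} (h : ∀ i ∈ T, a i ∈ N) (i : I) : prodGE T a i ∈ N :=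
  prod_mem fun j hj => h j (Finset.mem_filter.mp hj).1

lemma map_prodGE {A B F : Type*} [CommMonoid A] [CommMonoid B] [FunLike F A B]
    [MonoidHomClass F A B] (f : F) (T : Finset I) (a : I → A) (i : I) :
    f (prodGE T a i) = prodGE T (fun j => f (a j)) i := map_prod _ _ _

variable {A B C R : Type*} [CommRing A] [CommRing B] [CommRing C] [CommRing R]
  {S : Finset I} {a : I → A} {M : I → Ideal A}

lemma exists_prodGE_mul_eq (hM : Monotone M) {p : A →+* B}
    (hp : ∀ s ∈ S, ∀ m ∈ M s, ∃ b, p (prodGE S a s) * b = p m) (i : I) {m : A} (hm : m ∈ M i) :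
    ∃ b, p (prodGE S a i) * b = p m := by
  obtain h | ⟨t, ht, hit, h⟩ := prodGE_eq_one_or_exists S a i
  · exact ⟨p m, by simp [h]⟩
  · rw [h]
    exact hp t ht m (hM hit hm)

/-- The universal property that the iterated deformation space satisfies: the elements of `M i`
become divisible by all `a j` with `j ≥ i`. First one divides by the `a j` with `j ∈ S`; the
quotient is in the kernel of `r k` for each `k ≥ i` outside `S`, and hence can be divided further. -/
lemma dvd_of_iterated [Fintype I] (hM : Monotone M) {p : A →+* B} {q : B →+* C}
    {R : I → Type*} [∀ k, CommRing (R k)] {r : ∀ k, B →+* R k}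
    (hp : ∀ s ∈ S, ∀ m ∈ M s, ∃ b, p (prodGE S a s) * b = p m)
    (hr : ∀ k ∈ Sᶜ, ∀ m ∈ M k, r k (p m) = 0)
    (hra : ∀ k ∈ Sᶜ, ∀ s ∈ S, r k (p (a s)) ∈ nonZeroDivisors (R k))
    (hq : ∀ k ∈ Sᶜ, ∀ b, r k b = 0 → q (p (prodGE Sᶜ a k)) ∣ q b)
    (i : I) {m : A} (hm : m ∈ M i) : q (p (∏ j with i ≤ j, a j)) ∣ q (p m) := by
  obtain ⟨b, hb⟩ := exists_prodGE_mul_eq hM hp i hm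
  rw [← prodGE_mul_prodGE_compl S, ← hb]
  simp only [map_mul]
  refine mul_dvd_mul_left _ ?_
  obtain h | ⟨k, hk, hik, h⟩ := prodGE_eq_one_or_exists Sᶜ a i
  · simp [h]
  · rw [h]
    refine hq k hk b ?_
    have h1 := congrArg (r k) hb
    rw [map_mul, hr k hk m (hM hik hm)] at h1
    refine (mul_left_mem_nonZeroDivisors_eq_zero_iff ?_).mp h1
    rw [map_prodGE, map_prodGE]
    exact prodGE_mem (hra k hk) i

section Kernel

variable {p : A →+* B} {q : B →+* C} {r : B →+* R} {k : I}

lemma mem_prod_pow_zero {ι : Type*} (M : ι → Ideal A) (T : Finset ι) (x : A) :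
    x ∈ ∏ s ∈ T, M s ^ (0 : ι → ℕ) s := by
  have h : ∏ s ∈ T, M s ^ (0 : ι → ℕ) s = 1 := Finset.prod_eq_one fun s _ => pow_zero (M s)
  rw [h, Ideal.one_eq_top]
  exact Submodule.mem_top

/-- The fractions with numerator in a product of powers of the `M s` with `s > k` and with the
corresponding denominator. They form a submonoid. -/
def monomials (S : Finset I) (a : I → A) (M : I → Ideal A) (p : A →+* B) (k : I) :
    Submonoid B where
  carrier := {b | ∃ θ : I → ℕ, ∃ c ∈ ∏ s ∈ S with k < s, M s ^ θ s,
    p (∏ s ∈ S with k < s, prodGE S a s ^ θ s) * b = p c}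
  one_mem' := ⟨0, 1, mem_prod_pow_zero M _ 1, by simp⟩
  mul_mem' := by
    rintro b b' ⟨θ, c, hc, e⟩ ⟨θ', c', hc', e'⟩
    refine ⟨θ + θ', c * c', ?_, ?_⟩
    · simp only [Pi.add_apply, pow_add, Finset.prod_mul_distrib]
      exact Ideal.mul_mem_mul hc hc'
    · simp only [Pi.add_apply, pow_add, Finset.prod_mul_distrib, map_mul, ← e, ← e']
      ring

lemma map_mem_monomials (x : A) : p x ∈ monomials S a M p k :=
  ⟨0, x, mem_prod_pow_zero M _ x, by simp⟩

lemma mem_monomials {s : I} (hs : s ∈ S) (hks : k < s) {b : B} {m : A} (hm : m ∈ M s)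
    (e : p (prodGE S a s) * b = p m) : b ∈ monomials S a M p k := by
  have hs' : s ∈ S.filter (k < ·) := Finset.mem_filter.mpr ⟨hs, hks⟩
  refine ⟨Pi.single s 1, m, ?_, ?_⟩
  · rw [Finset.prod_eq_single_of_mem s hs' fun t _ ht => by simp [ht]]
    simpa using hm
  · rw [Finset.prod_eq_single_of_mem s hs' fun t _ ht => by simp [ht]]
    simpa using e

lemma exists_sum_of_mem_closure {N : Submonoid B} (hN : ∀ b ∈ N, -b ∈ N) {b : B}
    (hb : b ∈ Subring.closure (N : Set B)) :
    ∃ (E : Type) (_ : Fintype E) (f : E → B), (∀ e, f e ∈ N) ∧ b = ∑ e, f e := by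
  rw [Subring.mem_closure_iff, Submonoid.closure_eq] at hb
  refine AddSubgroup.closure_induction (p := fun b _ => ∃ (E : Type) (_ : Fintype E) (f : E → B),
    (∀ e, f e ∈ N) ∧ b = ∑ e, f e) ?_ ?_ ?_ ?_ hb
  · exact fun x hx => ⟨Unit, inferInstance, fun _ => x, fun _ => hx, by simp⟩
  · exact ⟨Empty, inferInstance, Empty.elim, fun e => e.elim, by simp⟩
  · rintro x y _ _ ⟨E, _, f, hf, rfl⟩ ⟨E', _, f', hf', rfl⟩
    exact ⟨E ⊕ E', inferInstance, Sum.elim f f', by rintro (e | e) <;> simp [hf, hf'],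
      by simp [Fintype.sum_sum_type]⟩
  · rintro x _ ⟨E, _, f, hf, rfl⟩
    exact ⟨E, inferInstance, fun e => -f e, fun e => hN _ (hf e), by simp⟩

/-- Modulo an ideal that contains the fractions with numerators in `M s` for all `s < k`, the
ring `B` is generated by the fractions with numerators in `M s` with `s > k`. -/
lemma exists_add_of_closure_eq_top (hk : k ∉ S) (J : Ideal B)
    (hB : Subring.closure (Set.range p ∪
      ⋃ s ∈ S, {b | ∃ m ∈ M s, p (prodGE S a s) * b = p m}) = ⊤)
    (hJ : ∀ s ∈ S, s < k → ∀ m ∈ M s, ∀ b, p (prodGE S a s) * b = p m → b ∈ J) (b : B) :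
    ∃ b₀ ∈ J, ∃ b₁ ∈ Subring.closure (monomials S a M p k : Set B), b = b₀ + b₁ := by
  have hb : b ∈ Subring.closure _ := hB.ge (Subring.mem_top b)
  induction hb using Subring.closure_induction with
  | mem b hb =>
    obtain ⟨x, rfl⟩ | hb := hb
    · exact ⟨0, zero_mem _, _, Subring.subset_closure (map_mem_monomials x), (zero_add _).symm⟩
    · simp only [Set.mem_iUnion] at hb
      obtain ⟨s, hs, m, hm, e⟩ := hb
      obtain h | rfl | h := lt_trichotomy s k
      · exact ⟨b, hJ s hs h m hm b e, 0, zero_mem _, (add_zero _).symm⟩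
      · exact absurd hs hk
      · exact ⟨0, zero_mem _, b, Subring.subset_closure (mem_monomials hs h hm e),
          (zero_add _).symm⟩
  | zero => exact ⟨0, zero_mem _, 0, zero_mem _, (add_zero _).symm⟩
  | one => exact ⟨0, zero_mem _, 1, one_mem _, (zero_add _).symm⟩
  | add x y _ _ hx hy =>
    obtain ⟨x₀, hx₀, x₁, hx₁, rfl⟩ := hx
    obtain ⟨y₀, hy₀, y₁, hy₁, rfl⟩ := hy
    exact ⟨_, add_mem hx₀ hy₀, _, add_mem hx₁ hy₁, by ring⟩
  | neg x _ hx =>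
    obtain ⟨x₀, hx₀, x₁, hx₁, rfl⟩ := hx
    exact ⟨_, neg_mem hx₀, _, neg_mem hx₁, by ring⟩
  | mul x y _ _ hx hy =>
    obtain ⟨x₀, hx₀, x₁, hx₁, rfl⟩ := hx
    obtain ⟨y₀, hy₀, y₁, hy₁, rfl⟩ := hy
    exact ⟨_, add_mem (J.mul_mem_right (y₀ + y₁) hx₀) (J.mul_mem_left x₁ hy₀), _,
      mul_mem hx₁ hy₁, by ring⟩

/-- The images of the elements of the ideal `N` are divisible by the image of `w`. -/
def Divides (f : A →+* C) (w : A) (N : Ideal A) : Prop := ∀ x ∈ N, f w ∣ f x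

lemma Divides.mul {f : A →+* C} {w w' : A} {N N' : Ideal A} (h : Divides f w N)
    (h' : Divides f w' N') : Divides f (w * w') (N * N') := by
  intro x hx
  have : N * N' ≤ (Ideal.span {f (w * w')}).comap f := by
    refine Ideal.mul_le.mpr fun y hy z hz => ?_
    rw [Ideal.mem_comap, Ideal.mem_span_singleton, map_mul, map_mul]
    exact mul_dvd_mul (h y hy) (h' z hz)
  exact Ideal.mem_span_singleton.mp (this hx)

lemma Divides.one {f : A →+* C} {N : Ideal A} : Divides f 1 N := fun x _ => by simp

lemma Divides.pow {f : A →+* C} {w : A} {N : Ideal A} (h : Divides f w N) (n : ℕ) :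
    Divides f (w ^ n) (N ^ n) := by
  induction n with
  | zero => simpa using Divides.one
  | succ n ih => simpa only [pow_succ] using ih.mul h

lemma Divides.prod {f : A →+* C} {ι : Type*} {s : Finset ι} {w : ι → A} {N : ι → Ideal A}
    (h : ∀ i ∈ s, Divides f (w i) (N i)) : Divides f (∏ i ∈ s, w i) (∏ i ∈ s, N i) := by
  classical
  induction s using Finset.induction_on with
  | empty => simpa using Divides.one
  | insert i s hi ih =>
    rw [Finset.prod_insert hi, Finset.prod_insert hi]
    exact (h i (Finset.mem_insert_self i s)).mul
      (ih fun j hj => h j (Finset.mem_insert_of_mem hj))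

lemma Divides.of_dvd {f : A →+* C} {w w' : A} {N : Ideal A} (h : Divides f w N) (hw : w' ∣ w) :
    Divides f w' N := fun x hx => (map_dvd f hw).trans (h x hx)

/-- Intersecting `∏ M s ^ θ s` with `M k` replaces one factor `M s'`, where `s'` is the least
index that occurs, by the factor `M k`, which is divisible by more `a j`. -/
lemma divides_inf [Fintype I] {f : A →+* C}
    (hf : ∀ i, Divides f (∏ j with i ≤ j, a j) (M i))
    (hreg : ∀ (θ : I → ℕ) (s' : I), IsLeast {s | s ∈ S ∧ k < s ∧ 0 < θ s} s' →
      (∏ s ∈ S with k < s, M s ^ θ s) ⊓ M k ≤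
        (∏ s ∈ S with s' < s, M s ^ θ s) * M s' ^ (θ s' - 1) * M k) (θ : I → ℕ) :
    Divides f ((∏ s ∈ S with k < s, prodGE S a s ^ θ s) * prodGE Sᶜ a k)
      ((∏ s ∈ S with k < s, M s ^ θ s) ⊓ M k) := by
  have hf' (i) : Divides f (prodGE S a i * prodGE Sᶜ a i) (M i) := by
    rw [prodGE_mul_prodGE_compl]
    exact hf i
  have hfS (i) : Divides f (prodGE S a i) (M i) := (hf' i).of_dvd (dvd_mul_right _ _)
  obtain h | h := (S.filter fun s => k < s ∧ 0 < θ s).eq_empty_or_nonempty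
  · have h1 : ∏ s ∈ S with k < s, prodGE S a s ^ θ s = 1 := by
      refine Finset.prod_eq_one fun s hs => ?_
      have h2 : s ∉ S.filter fun s => k < s ∧ 0 < θ s := by simp [h]
      rw [Finset.mem_filter] at hs h2
      rw [show θ s = 0 by by_contra h3; exact h2 ⟨hs.1, hs.2, Nat.pos_of_ne_zero h3⟩, pow_zero]
    rw [h1, one_mul]
    exact fun x hx => (hf' k).of_dvd (dvd_mul_left _ _) x hx.2
  · let s' := (S.filter fun s => k < s ∧ 0 < θ s).min' h
    obtain ⟨hsS, hks, hθ⟩ := Finset.mem_filter.mp (Finset.min'_mem _ h)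
    have hmin (s) (hs : s ∈ S) (hks : k < s) (hθ : 0 < θ s) : s' ≤ s :=
      Finset.min'_le _ _ (Finset.mem_filter.mpr ⟨hs, hks, hθ⟩)
    change s' ∈ S at hsS
    change k < s' at hks
    change 0 < θ s' at hθ
    have h1 : ∏ s ∈ S with k < s, prodGE S a s ^ θ s =
        (∏ s ∈ S with s' < s, prodGE S a s ^ θ s) * prodGE S a s' ^ (θ s' - 1) *
          prodGE S a s' := by
      rw [mul_assoc, ← pow_succ, Nat.sub_add_cancel hθ]
      have h2 : S.filter (s' < ·) ⊆ (S.filter (k < ·)).erase s' := by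
        intro s hs
        rw [Finset.mem_filter] at hs
        exact Finset.mem_erase.mpr ⟨hs.2.ne', Finset.mem_filter.mpr ⟨hs.1, hks.trans hs.2⟩⟩
      rw [Finset.prod_subset h2, Finset.prod_erase_mul _ _ (Finset.mem_filter.mpr ⟨hsS, hks⟩)]
      intro s hs hs'
      obtain ⟨hne, hs⟩ := Finset.mem_erase.mp hs
      obtain ⟨hs, hks⟩ := Finset.mem_filter.mp hs
      obtain h3 | h3 := Nat.eq_zero_or_pos (θ s)
      · rw [h3, pow_zero]
      · exact absurd (Finset.mem_filter.mpr ⟨hs, (hmin s hs hks h3).lt_of_ne hne.symm⟩) hs'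
    have h2 : Divides f (prodGE S a s' * prodGE Sᶜ a k) (M k) :=
      (hf' k).of_dvd (mul_dvd_mul_right (prodGE_dvd _ _ hks.le) _)
    have h3 := ((Divides.prod (s := S.filter (s' < ·)) fun s _ => (hfS s).pow (θ s)).mul
      ((hfS s').pow (θ s' - 1))).mul h2
    rw [h1, mul_assoc]
    exact fun x hx => h3 x (hreg θ s' ⟨⟨hsS, hks, hθ⟩, fun s hs => hmin s hs.1 hs.2.1 hs.2.2⟩ hx)

/-- Under the regularity conditions, the elements of the kernel of `r` become divisible by
all `a j` with `j ≥ k` outside `S`. Modulo fractions with numerators in `M s`, `s < k`, an element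
of the kernel is a sum of fractions with numerators in monomials in the `M s`, `s > k`.
With a common denominator, its numerator is in `M k`, and the regularity conditions allow to
rewrite it such that each summand is in `M k`. -/
lemma dvd_of_mem_ker [Fintype I] (hM : Monotone M) (hk : k ∈ Sᶜ)
    (hB : Subring.closure (Set.range p ∪
      ⋃ s ∈ S, {b | ∃ m ∈ M s, p (prodGE S a s) * b = p m}) = ⊤)
    (hr : ∀ m, r (p m) = 0 ↔ m ∈ M k)
    (hra : ∀ s ∈ S, r (p (a s)) ∈ nonZeroDivisors R)
    (hqa : ∀ i, q (p (a i)) ∈ nonZeroDivisors C)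
    (hq : ∀ i, ∀ m ∈ M i, q (p (∏ j with i ≤ j, a j)) ∣ q (p m))
    (hreg : ∀ (θ : I → ℕ) (s' : I), IsLeast {s | s ∈ S ∧ k < s ∧ 0 < θ s} s' →
      (∏ s ∈ S with k < s, M s ^ θ s) ⊓ M k ≤
        (∏ s ∈ S with s' < s, M s ^ θ s) * M s' ^ (θ s' - 1) * M k)
    (hreg' : (∃ s ∈ S, k < s) → ∀ (E : Type) (γ θ : E → I → ℕ),
      (⨆ e, Ideal.span {∏ s ∈ S, a s ^ γ e s} * ∏ s ∈ S with k < s, M s ^ θ e s) ⊓ M k ≤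
        ⨆ e, Ideal.span {∏ s ∈ S, a s ^ γ e s} * ((∏ s ∈ S with k < s, M s ^ θ e s) ⊓ M k))
    {b : B} (hb : r b = 0) : q (p (prodGE Sᶜ a k)) ∣ q b := by
  have hf (i) : Divides (q.comp p) (∏ j with i ≤ j, a j) (M i) := hq i
  have hqS (i) : q (p (prodGE S a i)) ∈ nonZeroDivisors C := by
    rw [map_prodGE, map_prodGE]
    exact prodGE_mem (fun j _ => hqa j) i
  have hrS (i) : r (p (prodGE S a i)) ∈ nonZeroDivisors R := by
    rw [map_prodGE, map_prodGE]
    exact prodGE_mem hra i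
  obtain ⟨b₀, ⟨hb₀, hb₀'⟩, b₁, hb₁, rfl⟩ := exists_add_of_closure_eq_top
    (Finset.mem_compl.mp hk) ((Ideal.span {q (p (prodGE Sᶜ a k))}).comap q ⊓ RingHom.ker r) hB
    (by
      intro s hs hsk m hm b e
      refine ⟨?_, ?_⟩
      · obtain ⟨c, hc⟩ := hq s m hm
        refine Ideal.mem_span_singleton.mpr ?_
        refine (map_dvd q (map_dvd p (prodGE_dvd Sᶜ a hsk.le))).trans ⟨c, ?_⟩
        refine (mul_cancel_left_mem_nonZeroDivisors (hqS s)).mp ?_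
        rw [← map_mul q, e, hc, ← prodGE_mul_prodGE_compl S, map_mul p, map_mul q, mul_assoc]
      · have h1 := congrArg r e
        rw [map_mul, (hr m).mpr (hM hsk.le hm)] at h1
        exact (mul_left_mem_nonZeroDivisors_eq_zero_iff (hrS s)).mp h1) b
  rw [SetLike.mem_coe, RingHom.mem_ker] at hb₀'
  rw [map_add, hb₀', zero_add] at hb
  rw [map_add]
  refine dvd_add (Ideal.mem_span_singleton.mp hb₀) ?_
  clear hb₀ hb₀' b₀
  by_cases hS : ∃ s ∈ S, k < s
  · obtain ⟨E, _, f, hfE, rfl⟩ := exists_sum_of_mem_closure (by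
      rintro b ⟨θ, c, hc, e⟩
      exact ⟨θ, -c, neg_mem hc, by rw [mul_neg, e, map_neg]⟩) hb₁
    choose θ c hc e using hfE
    let δ (x : E) (t : I) : ℕ := ∑ s ∈ S with k < s, if s ≤ t then θ x s else 0
    have hδ (x) : ∏ s ∈ S with k < s, prodGE S a s ^ θ x s = ∏ t ∈ S, a t ^ δ x t :=
      prod_prodGE_pow S a k (θ x)
    let N (t : I) : ℕ := ∑ x, δ x t
    let γ (x : E) (t : I) : ℕ := N t - δ x t
    have hγ (x) : (∏ t ∈ S, a t ^ γ x t) * ∏ t ∈ S, a t ^ δ x t = ∏ t ∈ S, a t ^ N t := by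
      rw [← Finset.prod_mul_distrib]
      refine Finset.prod_congr rfl fun t _ => ?_
      rw [← pow_add, Nat.sub_add_cancel]
      exact Finset.single_le_sum (f := fun x => δ x t) (fun _ _ => Nat.zero_le _)
        (Finset.mem_univ x)
    let y : A := ∑ x, (∏ t ∈ S, a t ^ γ x t) * c x
    have hy : p y = p (∏ t ∈ S, a t ^ N t) * ∑ x, f x := by
      rw [map_sum, Finset.mul_sum]
      refine Finset.sum_congr rfl fun x _ => ?_
      rw [map_mul, ← e, hδ, ← mul_assoc, ← map_mul, hγ]
    have hyk : y ∈ M k := (hr y).mp (by rw [hy, map_mul, hb, mul_zero])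
    have hy' : y ∈ ⨆ x, Ideal.span {∏ s ∈ S, a s ^ γ x s} * ∏ s ∈ S with k < s, M s ^ θ x s :=
      sum_mem fun x _ => Ideal.mem_iSup_of_mem x
        (Ideal.mul_mem_mul (Ideal.mem_span_singleton_self _) (hc x))
    have h1 : (⨆ x, Ideal.span {∏ s ∈ S, a s ^ γ x s} *
        ((∏ s ∈ S with k < s, M s ^ θ x s) ⊓ M k)) ≤
        (Ideal.span {q (p ((∏ t ∈ S, a t ^ N t) * prodGE Sᶜ a k))}).comap (q.comp p) := by
      refine iSup_le fun x => ?_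
      have h2 : Divides (q.comp p) (∏ s ∈ S, a s ^ γ x s)
          (Ideal.span {∏ s ∈ S, a s ^ γ x s}) := fun z hz =>
        map_dvd _ (Ideal.mem_span_singleton.mp hz)
      have h3 := h2.mul (divides_inf hf hreg (θ x))
      rw [hδ, ← mul_assoc, hγ] at h3
      exact fun z hz => Ideal.mem_span_singleton.mpr (h3 z hz)
    have h2 := Ideal.mem_span_singleton.mp (h1 (hreg' hS E γ θ ⟨hy', hyk⟩))
    obtain ⟨z, hz⟩ := h2
    have hN : q (p (∏ t ∈ S, a t ^ N t)) ∈ nonZeroDivisors C := by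
      simp only [map_prod, map_pow]
      exact prod_mem fun t _ => pow_mem (hqa t) _
    refine ⟨z, (mul_cancel_left_mem_nonZeroDivisors hN).mp ?_⟩
    rw [← map_mul, ← hy, ← mul_assoc, ← map_mul, ← map_mul]
    exact hz
  · have hS' : S.filter (k < ·) = ∅ := by
      rw [Finset.filter_eq_empty_iff]
      exact fun s hs hks => hS ⟨s, hs, hks⟩
    have h1 : Subring.closure (monomials S a M p k : Set B) ≤ p.range := by
      refine Subring.closure_le.mpr ?_
      rintro _ ⟨θ, c, -, e⟩
      rw [hS', Finset.prod_empty, map_one, one_mul] at e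
      exact ⟨c, e.symm⟩
    obtain ⟨x, rfl⟩ := h1 hb₁
    have h2 := hq k x ((hr x).mp hb)
    rw [← prodGE_mul_prodGE_compl S] at h2
    exact (map_dvd q (map_dvd p (dvd_mul_left _ _))).trans h2

end Kernel

end DeformationRing
/-! ### Deformation spaces and closed immersions between them -/

open Scheme.IdealSheafData DeformationRing

lemma isClosedImmersion_of_forall_exists {X Y : Scheme.{u}} (f : X ⟶ Y)
    (h : ∀ y : Y, ∃ U : Y.affineOpens, y ∈ U.1 ∧ IsAffineOpen (f ⁻¹ᵁ U.1) ∧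
      Function.Surjective (f.app U.1)) : IsClosedImmersion f := by
  choose U hU h1 h2 using h
  refine IsZariskiLocalAtTarget.of_iSup_eq_top (fun y => (U y).1)
    (eq_top_iff.mpr fun y _ => Opens.mem_iSup.mpr ⟨y, hU y⟩) fun y => ?_
  have key (W : Y.Opens) (hW : W = (U y).1) : Function.Surjective (f.app W) := hW ▸ h2 y
  have : IsAffine (U y).1.toScheme := (U y).2
  have : IsAffine (f ⁻¹ᵁ (U y).1).toScheme := h1 y
  refine IsClosedImmersion.of_surjective_of_isAffine _ ?_
  rw [morphismRestrict_appTop]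
  have h3 := ConcreteCategory.bijective_of_isIso (X.presheaf.map (eqToHom
    (image_morphismRestrict_preimage f (U y).1 ⊤)).op)
  exact h3.2.comp (key _ (Scheme.Opens.ι_image_top _))

namespace DeformationDatum

section

variable {X : Scheme.{u}} {I : Type v} [LinearOrder I] [Fintype I] (d : DeformationDatum X I)

instance : IsAffineHom d.toBase := inferInstanceAs (IsAffineHom d.multicenter.dilatationMap)

/-- The divisors of a deformation datum become Cartier divisors on the deformation space. -/
lemma isCartier_comap_divisor (i : I) : ((d.divisor i).comap d.toBase).IsCartier := by
  have h : ((∏ j with i ≤ j, d.divisor j).comap d.toBase).IsCartier :=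
    d.multicenter.isCartier_comap_divisor i
  rw [comap_prod] at h
  exact h.of_le (prod_le (fun j => (d.divisor j).comap d.toBase) (by simp))
    ((d.isLocallyPrincipal i).comap _)

lemma isCartier_comap {J : X.IdealSheafData} (hJ : J.IsCartier) :
    (J.comap d.toBase).IsCartier :=
  d.multicenter.isCartier_comap hJ

variable {d}

lemma isCartier_comap_multicenter {T : Scheme.{u}} {f : T ⟶ X}
    (h : ∀ i, ((d.divisor i).comap f).IsCartier) (i : I) :
    ((d.multicenter.divisor i).comap f).IsCartier := by
  change ((∏ j with i ≤ j, d.divisor j).comap f).IsCartier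
  rw [comap_prod]
  exact .prod _ fun j _ => h j

lemma hom_ext {T : Scheme.{u}} {p q : T ⟶ d.space} (f : T ⟶ X) (hp : p ≫ d.toBase = f)
    (hq : q ≫ d.toBase = f) (h : ∀ i, ((d.divisor i).comap f).IsCartier) : p = q := by
  refine Scheme.Multicenter.hom_ext (c := d.multicenter) (hp.trans hq.symm) ?_
  change ∀ i, (Scheme.IdealSheafData.comap _ (p ≫ d.toBase)).IsCartier
  rw [hp]
  exact isCartier_comap_multicenter h

lemma comp_eq_iff {T : Scheme.{u}} {p q : T ⟶ d.space} {f : T ⟶ X} (hq : q ≫ d.toBase = f)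
    (h : ∀ i, ((d.divisor i).comap f).IsCartier) : p ≫ d.toBase = f ↔ p = q :=
  ⟨fun hp => hom_ext f hp hq h, fun hp => hp ▸ hq⟩

lemma exists_lift {T : Scheme.{u}} (f : T ⟶ X) [IsAffineHom f]
    (h : ∀ i, ((d.divisor i).comap f).IsCartier)
    (hc : ∀ i, (d.center i).comap f ≤ (∏ j with i ≤ j, d.divisor j).comap f) :
    ∃ g : T ⟶ d.space, g ≫ d.toBase = f :=
  Scheme.Multicenter.exists_lift (c := d.multicenter) f (isCartier_comap_multicenter h) hc

variable (d) in
lemma exists_affine_forall_eq_span (x : X) : ∃ (U : X.AffineZariskiSite) (a : I → Γ(X, U.1)),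
    x ∈ U.1 ∧ ∀ i, (d.divisor i).ideal ⟨U.1, U.2⟩ = Ideal.span {a i} := by
  obtain ⟨U, hxU, h⟩ := exists_affineOpens_forall_eq_span Finset.univ
    (fun i _ => d.isLocallyPrincipal i) x
  choose a ha using fun i => h i (Finset.mem_univ i)
  exact ⟨⟨U.1, U.2⟩, a, hxU, ha⟩

section Affine

variable {U : X.AffineZariskiSite} {a : I → Γ(X, U.1)}
  (ha : ∀ i, (d.divisor i).ideal ⟨U.1, U.2⟩ = Ideal.span {a i})

include ha

lemma ideal_multicenter_divisor (i : I) : (d.multicenter.divisor i).ideal ⟨U.1, U.2⟩ =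
    Ideal.span {∏ j with i ≤ j, a j} :=
  ideal_prod_eq_span _ fun j _ => ha j

/-- The equation `f = d.toBase` is a hypothesis because `f` will be a composition that equals the
structure morphism only propositionally. -/
lemma prod_app_dvd {f : d.space ⟶ X} (hf : f = d.toBase) {i : I} {m : Γ(X, U.1)}
    (hm : m ∈ (d.center i).ideal ⟨U.1, U.2⟩) :
    (f.app U.1).hom (∏ j with i ≤ j, a j) ∣ (f.app U.1).hom m := by
  subst hf
  obtain ⟨b, hb⟩ := Scheme.Multicenter.exists_mul_eq_app (ideal_multicenter_divisor ha) hm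
  exact ⟨b, hb.symm⟩

lemma closure_app : Subring.closure (Set.range (d.toBase.app U.1).hom ∪
    ⋃ i, {b | ∃ m ∈ (d.center i).ideal ⟨U.1, U.2⟩,
      (d.toBase.app U.1).hom (∏ j with i ≤ j, a j) * b = (d.toBase.app U.1).hom m}) = ⊤ :=
  Scheme.Multicenter.closure_app (ideal_multicenter_divisor ha)

end Affine

end

section Pullback

variable {X : Scheme.{u}} {I : Type v} [LinearOrder I] [Fintype I] {d : DeformationDatum X I}
  {J : X.IdealSheafData} {U : X.AffineZariskiSite} {a : I → Γ(X, U.1)}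
  (ha : ∀ i, (d.divisor i).ideal ⟨U.1, U.2⟩ = Ideal.span {a i})
  {f : (d.pullback J.subschemeι).space ⟶ X}
  (hf : f = (d.pullback J.subschemeι).toBase ≫ J.subschemeι)

include ha

omit [Fintype I] in
lemma ideal_pullback_divisor (i : I) : ((d.pullback J.subschemeι).divisor i).ideal
    ⟨J.subschemeι ⁻¹ᵁ U.1, U.2.preimage _⟩ = Ideal.span {(J.subschemeι.app U.1).hom (a i)} := by
  rw [Scheme.Hom.app_eq_appLE]
  exact ideal_comap_eq_span _ J.subschemeι ⟨U.1, U.2⟩ ⟨_, U.2.preimage _⟩ le_rfl (ha i)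

include hf

/-- The functions on the deformation space of the pullback to a closed subscheme are generated by
functions on `X` and by fractions with numerator and denominator on `X`. -/
lemma closure_app_pullback : Subring.closure (Set.range (f.app U.1).hom ∪
    ⋃ i, {b | ∃ m ∈ (d.center i).ideal ⟨U.1, U.2⟩,
      (f.app U.1).hom (∏ j with i ≤ j, a j) * b = (f.app U.1).hom m}) = ⊤ := by
  subst hf
  have h := closure_app (d := d.pullback J.subschemeι) (U := ⟨_, U.2.preimage J.subschemeι⟩)
    (ideal_pullback_divisor ha)
  have hs : Function.Surjective (J.subschemeι.app U.1).hom := J.subschemeι.app_surjective U.1 U.2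
  refine top_le_iff.mp (le_trans (ge_of_eq h) ?_)
  refine Subring.closure_mono (Set.union_subset_union ?_ (Set.iUnion_mono fun i => ?_))
  · rintro _ ⟨x, rfl⟩
    obtain ⟨x, rfl⟩ := hs x
    exact ⟨x, rfl⟩
  · rintro b ⟨m, hm, e⟩
    have h1 : m ∈ ((d.center i).ideal ⟨U.1, U.2⟩).map (J.subschemeι.app U.1).hom := by
      rw [Scheme.Hom.app_eq_appLE]
      exact ((d.center i).ideal_comap J.subschemeι ⟨U.1, U.2⟩ ⟨_, U.2.preimage _⟩ le_rfl).le hm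
    obtain ⟨m', hm', rfl⟩ := (Ideal.mem_map_iff_of_surjective _ hs).mp h1
    refine ⟨m', hm', Eq.trans ?_ e⟩
    rw [← map_prod]
    rfl

lemma app_eq_zero_iff (h : ∀ i, ((d.divisor i).comap J.subschemeι).IsCartier) (m : Γ(X, U.1)) :
    (f.app U.1).hom m = 0 ↔ m ∈ J.ideal ⟨U.1, U.2⟩ := by
  subst hf
  have hinj : Function.Injective ((d.pullback J.subschemeι).toBase.app
      (J.subschemeι ⁻¹ᵁ U.1)).hom := by
    refine Scheme.Multicenter.app_injective_of_isCartier (U := ⟨_, U.2.preimage J.subschemeι⟩)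
      (ideal_multicenter_divisor (d := d.pullback J.subschemeι)
        (U := ⟨_, U.2.preimage J.subschemeι⟩) (ideal_pullback_divisor ha)) fun i => ?_
    exact .prod _ fun j _ => h j
  have h1 := J.ker_subschemeι_app ⟨U.1, U.2⟩
  rw [← h1, RingHom.mem_ker]
  exact map_eq_zero_iff _ hinj

end Pullback

end DeformationDatum
/-! ### Iterated deformation spaces -/

namespace DeformationDatum

variable {X : Scheme.{u}} {I : Type v} [LinearOrder I] (d : DeformationDatum X I) (S : Finset I)

/-- The preimage in `𝔻_S` of an affine open of `X`. -/
abbrev preim (U : X.AffineZariskiSite) : (d.restrict S).space.AffineZariskiSite :=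
  (d.restrict S).multicenter.preim U

lemma exists_preim_forall_eq_span [Fintype I] (y : (d.restrict S).space) :
    ∃ (U : X.AffineZariskiSite) (a : I → Γ(X, U.1)), y ∈ (d.preim S U).1 ∧
      ∀ i, (d.divisor i).ideal ⟨U.1, U.2⟩ = Ideal.span {a i} :=
  d.exists_affine_forall_eq_span ((d.restrict S).toBase y)

/-- The homomorphism from the functions on an affine open of `X` to the functions on its preimage
in `𝔻_S`. -/
abbrev baseMap (U : X.AffineZariskiSite) :
    Γ(X, U.1) →+* Γ((d.restrict S).space, (d.preim S U).1) :=
  ((d.restrict S).toBase.app U.1).hom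

/-- The pullback of functions along `F(k, S)`, over an affine open of `X`. -/
abbrev centerMap (k : I) (U : X.AffineZariskiSite) :
    Γ((d.restrict S).space, (d.preim S U).1) →+*
      Γ((d.onCenter S k).space, d.F S k ⁻¹ᵁ (d.preim S U).1) :=
  ((d.F S k).app (d.preim S U).1).hom

variable {d S} {U : X.AffineZariskiSite} {a : I → Γ(X, U.1)}
  (ha : ∀ i, (d.divisor i).ideal ⟨U.1, U.2⟩ = Ideal.span {a i})

section

include ha

lemma closure_baseMap : Subring.closure (Set.range (d.baseMap S U) ∪
    ⋃ s ∈ S, {b | ∃ m ∈ (d.center s).ideal ⟨U.1, U.2⟩,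
      d.baseMap S U (prodGE S a s) * b = d.baseMap S U m}) = ⊤ := by
  refine top_le_iff.mp (le_trans (ge_of_eq (closure_app (d := d.restrict S)
    (a := fun s => a s) fun s => ha s)) (Subring.closure_mono ?_))
  refine Set.union_subset_union_right _ (Set.iUnion_subset fun s => ?_)
  rintro b ⟨m, hm, e⟩
  rw [prod_subtype_with_le] at e
  exact Set.mem_biUnion s.2 ⟨m, hm, e⟩

lemma exists_baseMap_mul_eq (s : I) (hs : s ∈ S) (m : Γ(X, U.1))
    (hm : m ∈ (d.center s).ideal ⟨U.1, U.2⟩) :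
    ∃ b, d.baseMap S U (prodGE S a s) * b = d.baseMap S U m := by
  obtain ⟨b, hb⟩ := prod_app_dvd (d := d.restrict S) (a := fun s => a s) (fun s => ha s) rfl
    (i := ⟨s, hs⟩) hm
  rw [prod_subtype_with_le] at hb
  exact ⟨b, hb.symm⟩

/-- Functions and fractions on `X k` lift to functions and fractions on `X`. -/
lemma centerMap_surjective (k : I)
    (h : ∀ s ∈ S, ((d.divisor s).comap (d.F S k ≫ (d.restrict S).toBase)).IsCartier) :
    Function.Surjective (d.centerMap S k U) := by
  rw [← RingHom.range_eq_top, ← top_le_iff]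
  refine le_trans (ge_of_eq (closure_app_pullback (d := d.restrict S) (a := fun s => a s)
    (fun s => ha s) (d.F_toBase S k))) (Subring.closure_le.mpr ?_)
  rintro (b : Γ((d.onCenter S k).space, d.F S k ⁻¹ᵁ (d.preim S U).1)) (⟨x, rfl⟩ | hb)
  · exact ⟨d.baseMap S U x, rfl⟩
  · obtain ⟨s, m, hm, e⟩ := Set.mem_iUnion.mp hb
    obtain ⟨b', hb'⟩ := exists_baseMap_mul_eq ha s s.2 m hm
    refine ⟨b', ?_⟩
    rw [prod_subtype_with_le] at e
    have e' : d.centerMap S k U (d.baseMap S U (prodGE S a s)) * b =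
      d.centerMap S k U (d.baseMap S U m) := e
    rw [← hb', map_mul] at e'
    refine ((mul_cancel_left_mem_nonZeroDivisors ?_).mp e').symm
    rw [map_prodGE, map_prodGE]
    exact prodGE_mem (fun j hj => Scheme.Multicenter.app_mem_nonZeroDivisors (h j hj) (ha j)) _

end

/-- The divisors of index in `S` pull back to Cartier divisors on the source of `F(k, S)`. -/
lemma isCartier_comap_onCenter (k : I) {s : I} (hs : s ∈ S) :
    ((d.divisor s).comap ((d.onCenter S k).toBase ≫ (d.center k).subschemeι)).IsCartier := by
  rw [comap_comp]
  exact (d.onCenter S k).isCartier_comap_divisor ⟨s, hs⟩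

variable (d S) in
lemma isClosedImmersion_F [Fintype I] (k : I) : IsClosedImmersion (d.F S k) := by
  refine isClosedImmersion_of_forall_exists _ fun y => ?_
  obtain ⟨U, a, hy, ha⟩ := d.exists_preim_forall_eq_span S y
  have e : IsAffineHom (d.F S k ≫ (d.restrict S).toBase) := by
    rw [F_toBase]
    infer_instance
  refine ⟨⟨_, (d.preim S U).2⟩, hy, U.2.preimage (d.F S k ≫ (d.restrict S).toBase),
    centerMap_surjective ha k fun s hs => ?_⟩
  rw [F_toBase]
  exact isCartier_comap_onCenter k hs

section

include ha

lemma centerMap_mem_nonZeroDivisors (k : I) {s : I} (hs : s ∈ S) :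
    d.centerMap S k U (d.baseMap S U (a s)) ∈ nonZeroDivisors _ := by
  have h1 := isCartier_comap_onCenter (d := d) k hs
  rw [← F_toBase] at h1
  exact Scheme.Multicenter.app_mem_nonZeroDivisors h1 (ha s)

/-- A function on `X` that vanishes on the source of `F(k, S)` vanishes on `X k`, because the
divisors are Cartier on `X k`. -/
lemma centerMap_baseMap_eq_zero_iff {k : I}
    (h : ∀ j : I, ((d.divisor j).comap (d.center k).subschemeι).IsCartier) (m : Γ(X, U.1)) :
    d.centerMap S k U (d.baseMap S U m) = 0 ↔ m ∈ (d.center k).ideal ⟨U.1, U.2⟩ :=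
  app_eq_zero_iff (d := d.restrict S) (a := fun s => a s) (fun s => ha s) (d.F_toBase S k)
    (fun s => h s) m

variable [Fintype I]

lemma ideal_iterated_divisor (k : (Sᶜ : Finset I)) :
    ((d.iterated S).divisor k).ideal ⟨(d.preim S U).1, (d.preim S U).2⟩ =
      Ideal.span {d.baseMap S U (a k)} :=
  (d.restrict S).multicenter.ideal_comap_dilatationMap (ha k)

omit ha in
lemma mem_ideal_iterated_center (k : (Sᶜ : Finset I))
    (b : Γ((d.restrict S).space, (d.preim S U).1)) :
    b ∈ ((d.iterated S).center k).ideal ⟨(d.preim S U).1, (d.preim S U).2⟩ ↔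
      d.centerMap S k U b = 0 := by
  have := d.isClosedImmersion_F S k
  exact iff_of_eq (congrArg (b ∈ ·)
    (Scheme.Hom.ker_apply (d.F S k) ⟨(d.preim S U).1, (d.preim S U).2⟩))

lemma ideal_iterated_multicenter_divisor (k : (Sᶜ : Finset I)) :
    (∏ j with k ≤ j, (d.iterated S).divisor j).ideal ⟨(d.preim S U).1, (d.preim S U).2⟩ =
      Ideal.span {d.baseMap S U (prodGE Sᶜ a k)} := by
  rw [ideal_prod_eq_span _ fun j _ => ideal_iterated_divisor ha j, map_prodGE,
    prod_subtype_with_le Sᶜ fun j => d.baseMap S U (a j)]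

lemma iterated_app_dvd {k : I} (hk : k ∈ Sᶜ)
    (b : Γ((d.restrict S).space, (d.preim S U).1)) (hb : d.centerMap S k U b = 0) :
    ((d.iterated S).toBase.app (d.preim S U).1).hom (d.baseMap S U (prodGE Sᶜ a k)) ∣
      ((d.iterated S).toBase.app (d.preim S U).1).hom b := by
  have h1 := prod_app_dvd (d := d.iterated S) (U := d.preim S U) (ideal_iterated_divisor ha) rfl
    (i := ⟨k, hk⟩) ((mem_ideal_iterated_center ⟨k, hk⟩ b).mpr hb)
  rwa [prod_subtype_with_le Sᶜ fun j => d.baseMap S U (a j),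
    ← map_prodGE (d.baseMap S U)] at h1

end

variable [Fintype I]

variable (d S) in
/-- All divisors pull back to Cartier divisors on the iterated deformation space. -/
lemma isCartier_comap_iterated (i : I) :
    ((d.divisor i).comap ((d.iterated S).toBase ≫ (d.restrict S).toBase)).IsCartier := by
  rw [comap_comp]
  by_cases hi : i ∈ S
  · exact (d.iterated S).isCartier_comap ((d.restrict S).isCartier_comap_divisor ⟨i, hi⟩)
  · exact (d.iterated S).isCartier_comap_divisor ⟨i, Finset.mem_compl.mpr hi⟩

/-- The iterated deformation space satisfies the universal property of the deformation space,
without any regularity condition. -/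
lemma exists_hom_iterated
    (h : ∀ i j : I, ((d.divisor j).comap (d.center i).subschemeι).IsCartier) :
    ∃ Θ : (d.iterated S).space ⟶ d.space,
      Θ ≫ d.toBase = (d.iterated S).toBase ≫ (d.restrict S).toBase := by
  refine exists_lift _ (d.isCartier_comap_iterated S) fun i => ?_
  refine comap_le_comap_of_dvd _ fun x => ?_
  obtain ⟨U, a, hxU, ha⟩ := d.exists_affine_forall_eq_span x
  refine ⟨⟨U.1, U.2⟩, hxU, _, ideal_prod_eq_span _ fun j _ => ha j, fun m hm => ?_⟩
  exact dvd_of_iterated (S := S) (M := fun i => (d.center i).ideal ⟨U.1, U.2⟩)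
    (p := d.baseMap S U) (q := ((d.iterated S).toBase.app (d.preim S U).1).hom)
    (r := fun k => d.centerMap S k U)
    (fun i j hij => d.monotone_center hij _) (exists_baseMap_mul_eq ha)
    (fun k _ m hm => (centerMap_baseMap_eq_zero_iff ha (h k) m).mpr hm)
    (fun k _ s hs => centerMap_mem_nonZeroDivisors ha k hs)
    (fun k hk b hb => iterated_app_dvd ha hk b hb) i hm

variable (d S) in
lemma exists_hom_restrict :
    ∃ Ψ : d.space ⟶ (d.restrict S).space, Ψ ≫ (d.restrict S).toBase = d.toBase := by
  refine exists_lift _ (fun s => d.isCartier_comap_divisor s) fun s => ?_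
  refine comap_le_comap_of_dvd _ fun x => ?_
  obtain ⟨U, a, hxU, ha⟩ := d.exists_affine_forall_eq_span x
  refine ⟨⟨U.1, U.2⟩, hxU, _, ideal_prod_eq_span _ fun j _ => ha j, fun m hm => ?_⟩
  refine dvd_trans (map_dvd _ ?_) (prod_app_dvd ha rfl (i := (s : I)) hm)
  rw [prod_subtype_with_le, ← prodGE_mul_prodGE_compl S]
  exact dvd_mul_right _ _

/-- Under the regularity conditions, the deformation space satisfies the universal property of
the iterated deformation space. -/
lemma exists_hom_to_iterated
    (h : ∀ i j : I, ((d.divisor j).comap (d.center i).subschemeι).IsCartier)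
    (hreg : d.IsRegular S) {Ψ : d.space ⟶ (d.restrict S).space}
    (hΨ : Ψ ≫ (d.restrict S).toBase = d.toBase) :
    ∃ Ξ : d.space ⟶ (d.iterated S).space, Ξ ≫ (d.iterated S).toBase = Ψ := by
  have hC (j : I) : ((d.divisor j).comap (Ψ ≫ (d.restrict S).toBase)).IsCartier := by
    rw [hΨ]
    exact d.isCartier_comap_divisor j
  have : IsAffineHom (Ψ ≫ (d.restrict S).toBase) := by
    rw [hΨ]
    infer_instance
  have : IsAffineHom Ψ := .of_comp Ψ (d.restrict S).toBase
  refine exists_lift (d := d.iterated S) Ψ (fun k => ?_) fun k => ?_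
  · have h1 := hC k
    rw [comap_comp] at h1
    exact h1
  refine comap_le_comap_of_dvd _ fun y => ?_
  obtain ⟨U, a, hy, ha⟩ := d.exists_preim_forall_eq_span S y
  refine ⟨⟨(d.preim S U).1, (d.preim S U).2⟩, hy, _,
    ideal_iterated_multicenter_divisor ha k, fun b hb => ?_⟩
  refine dvd_of_mem_ker (S := S) (M := fun i => (d.center i).ideal ⟨U.1, U.2⟩)
    (p := d.baseMap S U) (q := (Ψ.app (d.preim S U).1).hom) (r := d.centerMap S k U)
    (fun i j hij => d.monotone_center hij _) k.2 (closure_baseMap ha)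
    (centerMap_baseMap_eq_zero_iff ha (h k)) (fun s hs => centerMap_mem_nonZeroDivisors ha k hs)
    (fun i => Scheme.Multicenter.app_mem_nonZeroDivisors (hC i) (ha i))
    (fun i m hm => prod_app_dvd ha hΨ hm) ?_ ?_ ((mem_ideal_iterated_center k b).mp hb)
  · intro θ s' hs'
    have h1 := congrArg (fun J : X.IdealSheafData => J.ideal ⟨U.1, U.2⟩)
      (hreg.sum_union k k.2 θ s' hs')
    simp only [ideal_inf, ideal_mul, Pi.inf_apply, Pi.mul_apply, ideal_prod, ideal_pow,
      Pi.pow_apply] at h1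
    exact h1.le
  · intro hS E γ θ
    have h1 := congrArg (fun J : X.IdealSheafData => J.ideal ⟨U.1, U.2⟩)
      (hreg.inter_union k k.2 hS E γ θ)
    simp only [ideal_inf, ideal_iSup, ideal_mul, Pi.inf_apply, Pi.mul_apply, ideal_prod, ideal_pow,
      Pi.pow_apply, iSup_apply, ha, Ideal.span_singleton_pow, Ideal.prod_span_singleton] at h1
    exact h1.le

end DeformationDatum
end AlgebraicGeometry
end

theorem mainTheorem1 {X : Scheme.{u}} {I : Type v} [LinearOrder I] [Fintype I]
    (d : DeformationDatum X I)
    (h : ∀ i j : I, ((d.divisor j).comap (d.center i).subschemeι).IsCartier) (S : Finset I) :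
    (∀ k ∈ Sᶜ, IsClosedImmersion (d.F S k) ∧
      ∀ f : (d.onCenter S k).space ⟶ (d.restrict S).space,
        f ≫ (d.restrict S).toBase = (d.onCenter S k).toBase ≫ (d.center k).subschemeι ↔
          f = d.F S k) ∧
    ∃ (Θ : (d.iterated S).space ⟶ d.space) (Ψ : d.space ⟶ (d.restrict S).space),
      (∀ Θ' : (d.iterated S).space ⟶ d.space,
        Θ' ≫ d.toBase = (d.iterated S).toBase ≫ (d.restrict S).toBase ↔ Θ' = Θ) ∧
      (∀ Φ' : (d.iterated S).space ⟶ (d.restrict S).space,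
        Φ' ≫ (d.restrict S).toBase = (d.iterated S).toBase ≫ (d.restrict S).toBase ↔
          Φ' = (d.iterated S).toBase) ∧
      (∀ Ψ' : d.space ⟶ (d.restrict S).space,
        Ψ' ≫ (d.restrict S).toBase = d.toBase ↔ Ψ' = Ψ) ∧
      (∀ Θ' : (d.iterated S).space ⟶ d.space, Θ' ≫ Ψ = (d.iterated S).toBase ↔ Θ' = Θ) ∧
      (d.IsRegular S → IsIso Θ) := by
  refine ⟨fun k _ => ⟨d.isClosedImmersion_F S k, fun f => DeformationDatum.comp_eq_iff
    (d.F_toBase S k) fun s => DeformationDatum.isCartier_comap_onCenter k s.2⟩, ?_⟩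
  obtain ⟨Θ, hΘ⟩ := DeformationDatum.exists_hom_iterated (S := S) h
  obtain ⟨Ψ, hΨ⟩ := d.exists_hom_restrict S
  have hC := d.isCartier_comap_iterated S
  have hΘ' (Θ' : (d.iterated S).space ⟶ d.space) := DeformationDatum.comp_eq_iff (p := Θ') hΘ hC
  have hΦ (Φ' : (d.iterated S).space ⟶ (d.restrict S).space) :=
    DeformationDatum.comp_eq_iff (p := Φ') (q := (d.iterated S).toBase) rfl fun s => hC s
  have hΘΨ : Θ ≫ Ψ = (d.iterated S).toBase := by
    rw [← hΦ, Category.assoc, hΨ, hΘ]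
  refine ⟨Θ, Ψ, hΘ', hΦ, fun Ψ' => DeformationDatum.comp_eq_iff hΨ fun s =>
    d.isCartier_comap_divisor s, fun Θ' => ⟨fun e => ?_, fun e => e ▸ hΘΨ⟩, fun hreg => ?_⟩
  · rw [← hΘ', ← e, Category.assoc, hΨ]
  · obtain ⟨Ξ, hΞ⟩ := DeformationDatum.exists_hom_to_iterated h hreg hΨ
    refine ⟨Ξ, ?_, ?_⟩
    · refine DeformationDatum.hom_ext (d.iterated S).toBase ?_ (Category.id_comp _)
        (d.iterated S).isCartier_comap_divisor
      rw [Category.assoc, hΞ, hΘΨ]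
    · refine DeformationDatum.hom_ext d.toBase ?_ (Category.id_comp _) d.isCartier_comap_divisor
      rw [Category.assoc, hΘ, reassoc_of% hΞ, hΨ]
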